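/- **Theorem (Bidding with Uncertainty).** *Model.* Let $\delta\in(0,1]$, $\lambda\ge 0$, and let bidder values have a density $f\ge 0$ with c.d.f. $F$, no mass below $0$, and support infimum $\underline X\ge 0$. For $r\ge 0$ consider the Markov chain on $\{0,1,2,\dots\}$ that from $n$ moves to $B+\Lambda$, where $B\sim\mathrm{Bin}((n-1)_+,1-\delta)$ and $\Lambda\sim\mathrm{Poisson}(r)$ are independent (one winner leaves, every other bidder is removed with probability $\delta$, new bidders arrive). Write $p_0^{(\delta,r)}$ for the probability of state $0$ in its stationary distribution. The stationary winner c.d.f. is $W(g)=p_0^{(\delta,\lambda(1-g))}$, $g\in[0,1]$, and $w=W'$ is its density (one-sided derivatives at $0$ and $1$). *Equilibrium.* Suppose all other bidders bid according to $b$. In each round, independently of the other rounds, a bidder of value $x$ who bids $\beta\ge0$ wins with probability $$P_x(\beta)=p_0^{(\delta,\,\lambda\,\Pr[A])},\qquad A=\{b(X)>\beta\}\cup\{b(X)=\beta,\ X>x\},$$ where $X$ has c.d.f. $F$ (equal bids are tie-broken by value, and she wins exactly when no bidder who would beat her is in the stationary pool). The winner pays her bid; a bidder who does not win is removed with probability $\delta$.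 Her payoff from bidding $\beta_0,\beta_1,\dots$ in successive rounds is $$V_x(\beta_0,\beta_1,\dots)=\sum_{n\ge 0}\Big(\prod_{m<n}(1-\delta)(1-P_x(\beta_m))\Big)P_x(\beta_n)(x-\beta_n).$$ The function $b$ is an equilibrium bidding function if for every $x$ in the support of the value distribution $b(x)\ge 0$ and $V_x(\beta_0,\beta_1,\dots)\le V_x(b(x),b(x),\dots)$ for every bounded sequence of nonnegative bids. *Claim.* 1. For every $g\in[0,1]$ the chain with $r=\lambda(1-g)$ has exactly one stationary distribution; $W>0$ on $[0,1]$, and $W$ is continuously differentiable on $[0,1]$ with derivative $w$. 2. A function $b:\mathbb R\to\mathbb R$ is an equilibrium bidding function if and only if for all $x$ in the support of the value distribution $$b(x)=\Big[\frac1{W(F(x))}+\frac{1-\delta}{\delta}\Big]\int_{\underline X}^x\frac{z\,w(F(z))f(z)}{\big[1+\frac{1-\delta}{\delta}W(F(z))\big]^2}\,dz .$$ The integral exists for every $x\ge\underline X$, and the right-hand side is weakly increasing in $x\ge\underline X$. 3. The function $b$ given by this formula satisfies $b(x)<x$, is differentiable at $x$, and solves $$\frac{b'(x)}{x-b(x)}=\frac{w(F(x))f(x)}{\big[1+\frac{1-\delta}{\delta}W(F(x))\big]W(F(x))}$$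 for almost every $x>\underline X$, and also at every $x>\underline X$ at which $f$ is continuous. -/

import Mathlib

open MeasureTheory Set

noncomputable section

namespace UnendingAuction

/-! ### The bidder pool -/

/-- Transition probability `n → k` of the pool-size chain with removal probability `δ` and mean
number `r` of arrivals: if the pool is non-empty one bidder (the winner) leaves, each of the
remaining `(n - 1)₊` bidders independently stays with probability `1 - δ`, and then an independent
Poisson(`r`) number of bidders arrives. In the sum, `j` is the number of bidders who stay. -/
def poolKernel (δ r : ℝ) (n k : ℕ) : ℝ :=
  ∑ j ∈ Finset.range (k + 1),
    (((n - 1).choose j : ℝ) * (1 - δ) ^ j * δ ^ (n - 1 - j)) *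
      (Real.exp (-r) * r ^ (k - j) / ((k - j).factorial : ℝ))

/-- `p` is a stationary probability distribution of the pool-size chain. -/
structure IsStationary (δ r : ℝ) (p : ℕ → ℝ) : Prop where
  nonneg : ∀ n, 0 ≤ p n
  hasSum_one : HasSum p 1
  invariant : ∀ k, HasSum (fun n => p n * poolKernel δ r n k) (p k)

open Classical in
/-- The stationary probability of an empty pool, for removal probability `δ` and mean number `r`
of arrivals. (The default `0` is used only if there is no stationary distribution.) -/
def emptyProb (δ r : ℝ) : ℝ :=
  if h : ∃ p, IsStationary δ r p then h.choose 0 else 0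

/-- The stationary winner c.d.f. `W` at percentile `g ∈ [0, 1]`: the stationary probability that
the pool contains no bidder of percentile above `g`, these bidders forming a pool of their own with
Poisson(`lam * (1 - g)`) arrivals. -/
def winnerCDF (δ lam g : ℝ) : ℝ := emptyProb δ (lam * (1 - g))

/-- The stationary winner density `w` on `[0, 1]` (a one-sided derivative at the end points). -/
def winnerDensity (δ lam g : ℝ) : ℝ := derivWithin (winnerCDF δ lam) (Icc 0 1) g

/-! ### Bidder values -/

/-- The law of a bidder's value, with density `f`. -/
def valueLaw (f : ℝ → ℝ) : Measure ℝ := volume.withDensity fun x => ENNReal.ofReal (f x)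

/-- The c.d.f. `F` of a bidder's value. -/
def valueCDF (f : ℝ → ℝ) (x : ℝ) : ℝ := ProbabilityTheory.cdf (valueLaw f) x

/-- The infimum of the support of the value distribution. -/
def lowestValue (f : ℝ → ℝ) : ℝ := sInf (valueLaw f).support

/-! ### The auction as seen by one bidder -/

/-- The probability that, in one round, a bidder of value `x` wins with the bid `β`, when everyone
else bids according to `b` and the pool is in its stationary regime. A competitor of value `z`
beats her if `b z > β`, or if `b z = β` and `z > x` (equal bids are tie-broken by value). These
competitors arrive as a thinned Poisson stream, and as long as one of them is present the winner is
one of them; she wins exactly if none of them is in the pool. -/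
def winProb (δ lam : ℝ) (f b : ℝ → ℝ) (x β : ℝ) : ℝ :=
  emptyProb δ (lam * (valueLaw f).real {z | β < b z ∨ (b z = β ∧ x < z)})

/-- The expected payoff of a bidder of value `x` who bids `β 0, β 1, β 2, …` in successive rounds
until she wins (paying her bid) or is removed, when everyone else bids according to `b`. The highest
competitor in each round is an independent draw from the stationary regime, and a bidder who
does not win is removed with probability `δ`. -/
def payoff (δ lam : ℝ) (f b : ℝ → ℝ) (x : ℝ) (β : ℕ → ℝ) : ℝ :=
  ∑' n, (∏ m ∈ Finset.range n, (1 - δ) * (1 - winProb δ lam f b x (β m))) *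
    (winProb δ lam f b x (β n) * (x - β n))

/-- `b` is a stationary symmetric equilibrium bidding function: a bidder of any value `x` in the
support makes a nonnegative bid `b x`, and cannot improve her payoff over that of bidding `b x`
in every round by changing her bid in any or all rounds. (Bounded plans have a summable payoff
series when `δ > 0`.) -/
def IsEquilibrium (δ lam : ℝ) (f b : ℝ → ℝ) : Prop :=
  ∀ x ∈ (valueLaw f).support, 0 ≤ b x ∧
    ∀ β : ℕ → ℝ, (∀ n, 0 ≤ β n) → BddAbove (range β) →
      payoff δ lam f b x β ≤ payoff δ lam f b x fun _ => b x

/-! ### The bidding formula -/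

/-- The integrand `z w(F(z)) f(z) / [1 + ((1-δ)/δ) W(F(z))]²`. -/
def bidIntegrand (δ lam : ℝ) (f : ℝ → ℝ) (z : ℝ) : ℝ :=
  z * winnerDensity δ lam (valueCDF f z) * f z /
    (1 + (1 - δ) / δ * winnerCDF δ lam (valueCDF f z)) ^ 2

/-- The explicit bidding function. -/
def bidFormula (δ lam : ℝ) (f : ℝ → ℝ) (x : ℝ) : ℝ :=
  (1 / winnerCDF δ lam (valueCDF f x) + (1 - δ) / δ) *
    ∫ z in (lowestValue f)..x, bidIntegrand δ lam f z

/-- `b` is differentiable at `x`, `b(x) < x`, and the bidding differential equation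
`b'(x) / (x - b(x)) = w(F(x)) f(x) / ([1 + ((1-δ)/δ) W(F(x))] W(F(x)))` holds at `x`. -/
def SolvesBiddingODEAt (δ lam : ℝ) (f b : ℝ → ℝ) (x : ℝ) : Prop :=
  b x < x ∧ DifferentiableAt ℝ b x ∧
    deriv b x / (x - b x) =
      winnerDensity δ lam (valueCDF f x) * f x /
        ((1 + (1 - δ) / δ * winnerCDF δ lam (valueCDF f x)) * winnerCDF δ lam (valueCDF f x))

end UnendingAuction

end

namespace UnendingAuction

open Filter Topology

/-! ### The transition kernel of the pool-size chain -/

section Kernel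

variable {δ r : ℝ}

/-! The chain. Stationarity gives the generating function `G` of the pool size a functional equation
linking `G z` to `G u` with `u = δ + (1 - δ) z`. Iterated from `z = 0`, where `G 0 = p 0`, towards
the fixed point `1`, where `G 1 = 1`, it determines `p 0`: its reciprocal is the limit of the
explicit sequence `emptyRecipSeq` (`IsStationary.tendsto_emptyRecipSeq`). The terms increase in `r`
and extend to entire functions converging locally uniformly, so `W` is positive, monotone and C¹.
Existence comes from solving a contractive recursion for the tail of the pool size, uniqueness from
the positivity of `p 0`.

The auction. A bidder who always bids `β` and so always faces percentile `g` earns `(x - β) Ψ(g) /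
δ` with `Ψ = bidWeight = W / (1 + ((1-δ)/δ) W)`, and no plan beats the best constant one
(`payoff_le`). What remains is a static first-price auction with winning weight `Ψ`. The formula
says `b(x) Ψ(F x) = ∫ z dΨ(F z)`, so the loss of type `x` from imitating `y` is `∫_y^x (x - z) dΨ(F
z) ≥ 0` (`surplus_bidFormula_le`); this carries sufficiency and monotonicity.

For necessity, any equilibrium surplus obeys the same envelope inequalities
(`IsEquilibrium.surplus`). Two surpluses with equal slopes `Ψ(F x)` differ by second-order
increments only, hence by a constant on the support (`eq_of_abs_sub_le_mul_valueCDF`), and the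
lowest type bids `0` under both. -/

theorem poolKernel_nonneg (hδ0 : 0 < δ) (hδ1 : δ ≤ 1) (hr : 0 ≤ r) (n k : ℕ) :
    0 ≤ poolKernel δ r n k := by
  have : 0 ≤ 1 - δ := by linarith
  exact Finset.sum_nonneg fun j _ => by positivity

/-- The kernel row is the convolution of a binomial and a Poisson law, so its generating function is
a Cauchy product of the two. -/
theorem hasSum_poolKernel_mul_pow (δ r : ℝ) (n : ℕ) (z : ℝ) :
    HasSum (fun k => poolKernel δ r n k * z ^ k)
      ((δ + (1 - δ) * z) ^ (n - 1) * Real.exp (r * (z - 1))) := by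
  set B : ℕ → ℝ := fun j => ((n - 1).choose j : ℝ) * (1 - δ) ^ j * δ ^ (n - 1 - j) * z ^ j
  set A : ℕ → ℝ := fun j => Real.exp (-r) * r ^ j / (j.factorial : ℝ) * z ^ j
  have hB0 : ∀ j : ℕ, j ∉ Finset.range (n - 1 + 1) → B j = 0 := fun j hj => by
    have : n - 1 < j := by rw [Finset.mem_range] at hj; omega
    simp [B, Nat.choose_eq_zero_of_lt this]
  have hB : HasSum B ((δ + (1 - δ) * z) ^ (n - 1)) := by
    have h : HasSum B _ := hasSum_sum_of_ne_finset_zero hB0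
    convert! h using 1
    rw [add_comm, add_pow]
    refine Finset.sum_congr rfl fun j _ => ?_
    simp only [B, mul_pow]
    ring
  have hA : HasSum A (Real.exp (r * (z - 1))) := by
    have h := (NormedSpace.expSeries_div_hasSum_exp (r * z)).mul_left (Real.exp (-r))
    rw [← Real.exp_eq_exp_ℝ, ← Real.exp_add] at h
    convert! h using 1
    · funext j
      simp only [A, mul_pow]
      ring
    · ring_nf
  have h := hasSum_sum_range_mul_of_summable_norm hB.summable.norm hA.summable.norm
  rw [hB.tsum_eq, hA.tsum_eq] at h
  convert! h using 1
  funext k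
  rw [poolKernel, Finset.sum_mul]
  refine Finset.sum_congr rfl fun j hj => ?_
  have hjk : j ≤ k := Nat.lt_succ_iff.mp (Finset.mem_range.mp hj)
  simp only [A, B]
  rw [← pow_mul_pow_sub z hjk]
  ring

theorem hasSum_poolKernel (δ r : ℝ) (n : ℕ) : HasSum (poolKernel δ r n) 1 := by
  simpa using hasSum_poolKernel_mul_pow δ r n 1

theorem poolKernel_le_one (hδ0 : 0 < δ) (hδ1 : δ ≤ 1) (hr : 0 ≤ r) (n k : ℕ) :
    poolKernel δ r n k ≤ 1 :=
  le_hasSum (hasSum_poolKernel δ r n) k fun j _ => poolKernel_nonneg hδ0 hδ1 hr n j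

theorem poolKernel_zero_left (δ r : ℝ) (k : ℕ) : poolKernel δ r 0 k = poolKernel δ r 1 k := rfl

theorem poolKernel_one_left (δ r : ℝ) (k : ℕ) :
    poolKernel δ r 1 k = Real.exp (-r) * r ^ k / (k.factorial : ℝ) := by
  rw [poolKernel, Finset.sum_range_succ']
  simp

theorem poolKernel_succ_zero (δ r : ℝ) (n : ℕ) :
    poolKernel δ r (n + 2) 0 = δ * poolKernel δ r (n + 1) 0 := by
  simp [poolKernel, pow_succ]
  ring

/-- Condition on whether one distinguished losing bidder is removed or stays; analytically this is
Pascal's rule. -/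
theorem poolKernel_succ_succ (δ r : ℝ) (n k : ℕ) :
    poolKernel δ r (n + 2) (k + 1) =
      δ * poolKernel δ r (n + 1) (k + 1) + (1 - δ) * poolKernel δ r (n + 1) k := by
  simp only [poolKernel, Nat.add_sub_cancel, show n + 2 - 1 = n + 1 from rfl]
  rw [Finset.sum_range_succ' _ (k + 1), Finset.sum_range_succ' _ (k + 1), mul_add, Finset.mul_sum,
    Finset.mul_sum, add_right_comm, ← Finset.sum_add_distrib]
  congr 1
  · refine Finset.sum_congr rfl fun j _ => ?_
    rw [Nat.add_sub_add_right, Nat.add_sub_add_right, Nat.choose_succ_succ]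
    push_cast
    -- For `n < j + 1` the truncated exponent `n - (j + 1)` is wrong, but its binomial coefficient
    -- vanishes.
    rcases lt_or_ge n (j + 1) with h | h
    · rw [Nat.choose_eq_zero_of_lt h]
      push_cast
      ring
    · obtain ⟨m, rfl⟩ := Nat.exists_eq_add_of_le h
      rw [show j + 1 + m - j = m + 1 by omega, show j + 1 + m - (j + 1) = m by omega]
      ring
  · simp
    ring

/-- The absolute values of a summable signed invariant vector are again invariant. -/
theorem isStationary_abs_div (hδ0 : 0 < δ) (hδ1 : δ ≤ 1) (hr : 0 ≤ r) {d : ℕ → ℝ}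
    (hd : Summable d) (hinv : ∀ k, HasSum (fun n => d n * poolKernel δ r n k) (d k))
    (hne : ∃ n, d n ≠ 0) : IsStationary δ r fun n => |d n| / ∑' m, |d m| := by
  have hK := poolKernel_nonneg hδ0 hδ1 hr
  have habs : Summable fun n => |d n| := hd.abs
  set S := ∑' m, |d m| with hS
  have hSpos : 0 < S := by
    obtain ⟨n, hn⟩ := hne
    exact habs.tsum_pos (fun _ => abs_nonneg _) n (abs_pos.mpr hn)
  have hrow : ∀ n, HasSum (fun k => |d n| * poolKernel δ r n k) |d n| := fun n => by
    simpa using (hasSum_poolKernel δ r n).mul_left |d n|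
  have hprod : Summable fun x : ℕ × ℕ => |d x.1| * poolKernel δ r x.1 x.2 := by
    refine (summable_prod_of_nonneg fun x => mul_nonneg (abs_nonneg _) (hK _ _)).mpr
      ⟨fun n => (hrow n).summable, ?_⟩
    simpa only [(hrow _).tsum_eq] using habs
  have htot : ∑' x : ℕ × ℕ, |d x.1| * poolKernel δ r x.1 x.2 = S :=
    (hprod.hasSum.prod_fiberwise hrow).unique habs.hasSum
  have hsw : HasSum (fun x : ℕ × ℕ => |d x.2| * poolKernel δ r x.2 x.1) S := by
    rw [← htot]
    exact (Equiv.hasSum_iff (f := fun x : ℕ × ℕ => |d x.1| * poolKernel δ r x.1 x.2)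
      (Equiv.prodComm ℕ ℕ)).mpr hprod.hasSum
  have hcol : ∀ k, Summable fun n => |d n| * poolKernel δ r n k := fun k =>
    hsw.summable.prod_factor k
  set e : ℕ → ℝ := fun k => ∑' n, |d n| * poolKernel δ r n k
  have hesum : HasSum e S := hsw.prod_fiberwise fun k => (hcol k).hasSum
  have hle : ∀ k, |d k| ≤ e k := fun k => by
    have h1 : ∀ n, |d n * poolKernel δ r n k| = |d n| * poolKernel δ r n k := fun n => by
      rw [abs_mul, abs_of_nonneg (hK n k)]
    rw [← (hinv k).tsum_eq]
    have h2 : Summable fun n => ‖d n * poolKernel δ r n k‖ := by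
      simpa only [Real.norm_eq_abs, h1] using hcol k
    simpa only [Real.norm_eq_abs, h1] using norm_tsum_le_tsum_norm h2
  -- The kernel preserves total mass, so the termwise inequality `|d k| ≤ e k` between two families
  -- of the same sum `S` is an equality.
  have heq : ∀ k, e k = |d k| := by
    have h0 : HasSum (fun k => e k - |d k|) 0 := by
      have := hesum.sub habs.hasSum
      rwa [← hS, sub_self] at this
    have := (hasSum_zero_iff_of_nonneg fun k => sub_nonneg.mpr (hle k)).mp h0
    exact fun k => sub_eq_zero.mp (congrFun this k)
  have hone : HasSum (fun n => |d n| / S) 1 := by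
    have := habs.hasSum.div_const S
    rwa [← hS, div_self hSpos.ne'] at this
  refine ⟨fun n => div_nonneg (abs_nonneg _) hSpos.le, hone, fun k => ?_⟩
  have h : HasSum (fun n => |d n| * poolKernel δ r n k) |d k| := heq k ▸ (hcol k).hasSum
  have h' := h.div_const S
  simpa only [div_mul_eq_mul_div] using h'

end Kernel

/-! ### Existence of a stationary distribution -/

section Existence

variable {δ r : ℝ}

/-- The upper tail `P(Λ > k)` of the Poisson distribution with mean `r`. -/
noncomputable def poissonTail (r : ℝ) (k : ℕ) : ℝ :=
  1 - ∑ j ∈ Finset.range (k + 1), poolKernel 1 r 1 j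

theorem poissonTail_nonneg (hr : 0 ≤ r) (k : ℕ) : 0 ≤ poissonTail r k :=
  sub_nonneg.mpr <| sum_le_hasSum _
    (fun j _ => poolKernel_nonneg one_pos le_rfl hr 1 j) (hasSum_poolKernel 1 r 1)

/-- A Chernoff bound: since `E[2^Λ] = exp r`, the tail at `k` is at most `exp r / 2^(k+1)`. -/
theorem summable_poissonTail (hr : 0 ≤ r) : Summable (poissonTail r) := by
  set a : ℕ → ℝ := poolKernel 1 r 1
  have ha : ∀ j, 0 ≤ a j := poolKernel_nonneg one_pos le_rfl hr 1
  have hexp : HasSum (fun j => a j * 2 ^ j) (Real.exp r) := by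
    convert! hasSum_poolKernel_mul_pow 1 r 1 2 using 1
    norm_num
  have hsum : Summable fun k => Real.exp r * (1 / 2 : ℝ) ^ (k + 1) :=
    ((summable_nat_add_iff 1).mpr summable_geometric_two).mul_left _
  refine hsum.of_nonneg_of_le (poissonTail_nonneg hr) fun k => ?_
  have h1 : HasSum (fun j => a (j + (k + 1))) (poissonTail r k) :=
    (hasSum_nat_add_iff' (k + 1)).mpr (hasSum_poolKernel 1 r 1)
  have h2 : HasSum (fun j => a (j + (k + 1)) * 2 ^ (j + (k + 1)) * (1 / 2 : ℝ) ^ (k + 1))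
      ((Real.exp r - ∑ i ∈ Finset.range (k + 1), a i * 2 ^ i) * (1 / 2) ^ (k + 1)) :=
    ((hasSum_nat_add_iff' (k + 1)).mpr hexp).mul_right _
  refine (hasSum_le (fun j => ?_) h1 h2).trans ?_
  · rw [mul_assoc, pow_add, mul_assoc, ← mul_pow]
    norm_num
    exact le_mul_of_one_le_right (ha _) (one_le_pow₀ (by norm_num))
  · gcongr
    exact sub_le_self _ (Finset.sum_nonneg fun i _ => mul_nonneg (ha i) (by positivity))

/-- The iterates of the tail recursion; their sum over `i` is the tail of the stationary
distribution. -/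
noncomputable def tailIterate (δ r : ℝ) : ℕ → ℕ → ENNReal
  | 0, k => ENNReal.ofReal (poissonTail r k)
  | i + 1, k => ENNReal.ofReal (1 - δ) *
      ∑' n, tailIterate δ r i (n + 1) * ENNReal.ofReal (poolKernel δ r (n + 1) k)

/-- Rows of the kernel sum to one, so the tail recursion contracts the ℓ¹ norm by the factor `1 -
δ`. Working in `ENNReal` makes the interchange of sums free. -/
theorem tsum_tailIterate_le (hδ0 : 0 < δ) (hδ1 : δ ≤ 1) (hr : 0 ≤ r) (i : ℕ) :
    ∑' k, tailIterate δ r i k ≤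
      ENNReal.ofReal (1 - δ) ^ i * ∑' k, ENNReal.ofReal (poissonTail r k) := by
  induction i with
  | zero => simp [tailIterate]
  | succ i ih =>
    have hrow : ∀ n, ∑' k, ENNReal.ofReal (poolKernel δ r n k) = 1 := fun n => by
      rw [← ENNReal.ofReal_tsum_of_nonneg (poolKernel_nonneg hδ0 hδ1 hr n)
        (hasSum_poolKernel δ r n).summable, (hasSum_poolKernel δ r n).tsum_eq, ENNReal.ofReal_one]
    simp only [tailIterate]
    rw [ENNReal.tsum_mul_left, ENNReal.tsum_comm, pow_succ', mul_assoc]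
    simp only [ENNReal.tsum_mul_left, hrow, mul_one]
    gcongr
    exact (ENNReal.tsum_comp_le_tsum_of_injective (add_left_injective 1) _).trans ih

/-- With `t k = P(N > k)`, this is invariance after summation by parts: one more bidder in the pool
pushes the next size above `k` exactly when she stays and the others number `k`, which has
probability `(1 - δ)` times a kernel entry. A solution is the Neumann series of the contraction. -/
theorem exists_stationaryTail (hδ0 : 0 < δ) (hδ1 : δ ≤ 1) (hr : 0 ≤ r) :
    ∃ t : ℕ → ℝ, Summable t ∧ ∀ k,
      HasSum (fun n => (1 - δ) * (t (n + 1) * poolKernel δ r (n + 1) k)) (t k - poissonTail r k) := by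
  have hK := poolKernel_nonneg hδ0 hδ1 hr
  set T : ℕ → ENNReal := fun k => ∑' i, tailIterate δ r i k with hT
  have hTsum : ∑' k, T k ≠ ⊤ := by
    rw [hT, ENNReal.tsum_comm]
    refine ne_top_of_le_ne_top ?_ (ENNReal.tsum_le_tsum (tsum_tailIterate_le hδ0 hδ1 hr))
    rw [ENNReal.tsum_mul_right, ENNReal.tsum_geometric]
    refine ENNReal.mul_ne_top (ENNReal.inv_ne_top.mpr ?_) ?_
    · refine (tsub_pos_of_lt ?_).ne'
      rw [ENNReal.ofReal_lt_one]
      linarith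
    · rw [← ENNReal.ofReal_tsum_of_nonneg (poissonTail_nonneg hr) (summable_poissonTail hr)]
      exact ENNReal.ofReal_ne_top
  have hTtop : ∀ k, T k ≠ ⊤ := fun k => ENNReal.ne_top_of_tsum_ne_top hTsum k
  have hrec : ∀ k, T k = ENNReal.ofReal (poissonTail r k) +
      ENNReal.ofReal (1 - δ) * ∑' n, T (n + 1) * ENNReal.ofReal (poolKernel δ r (n + 1) k) := by
    intro k
    simp only [hT]
    rw [tsum_eq_zero_add' ENNReal.summable]
    simp only [tailIterate, ENNReal.tsum_mul_left, ← ENNReal.tsum_mul_right]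
    rw [ENNReal.tsum_comm]
  have hsum : Summable fun k => (T k).toReal := ENNReal.summable_toReal hTsum
  refine ⟨fun k => (T k).toReal, hsum, fun k => ?_⟩
  have hs : Summable fun n => (T (n + 1)).toReal * poolKernel δ r (n + 1) k :=
    ((summable_nat_add_iff 1).mpr hsum).of_nonneg_of_le
      (fun n => mul_nonneg ENNReal.toReal_nonneg (hK _ _))
      fun n => mul_le_of_le_one_right ENNReal.toReal_nonneg (poolKernel_le_one hδ0 hδ1 hr _ _)
  have hq : 0 ≤ 1 - δ := by linarith
  have heq : (T k).toReal = poissonTail r k +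
      (1 - δ) * ∑' n, (T (n + 1)).toReal * poolKernel δ r (n + 1) k := by
    have h1 : ∀ n, T (n + 1) * ENNReal.ofReal (poolKernel δ r (n + 1) k) =
        ENNReal.ofReal ((T (n + 1)).toReal * poolKernel δ r (n + 1) k) := fun n => by
      rw [ENNReal.ofReal_mul ENNReal.toReal_nonneg, ENNReal.ofReal_toReal (hTtop _)]
    have h0 : ∀ n, 0 ≤ (T (n + 1)).toReal * poolKernel δ r (n + 1) k := fun n =>
      mul_nonneg ENNReal.toReal_nonneg (hK _ _)
    rw [hrec k]
    simp only [h1]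
    rw [← ENNReal.ofReal_tsum_of_nonneg h0 hs, ← ENNReal.ofReal_mul hq,
      ← ENNReal.ofReal_add (poissonTail_nonneg hr k) (mul_nonneg hq (tsum_nonneg h0)),
      ENNReal.toReal_ofReal (add_nonneg (poissonTail_nonneg hr k)
        (mul_nonneg hq (tsum_nonneg h0)))]
  beta_reduce
  rw [heq, add_sub_cancel_left]
  exact hs.hasSum.mul_left _

/-- The differences `d` of the tail form an invariant vector of total mass one. Neither monotonicity
of `t` nor `t 0 ≤ 1` is needed, because `isStationary_abs_div` accepts a signed vector. -/
theorem exists_isStationary (hδ0 : 0 < δ) (hδ1 : δ ≤ 1) (hr : 0 ≤ r) :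
    ∃ p, IsStationary δ r p := by
  obtain ⟨t, ht, hrec⟩ := exists_stationaryTail hδ0 hδ1 hr
  set d : ℕ → ℝ := fun n => Nat.casesOn n (1 - t 0) fun m => t m - t (m + 1) with hd
  have hd0 : d 0 = 1 - t 0 := rfl
  have hds : ∀ m, d (m + 1) = t m - t (m + 1) := fun m => rfl
  have ht' : Summable fun n => t (n + 1) := (summable_nat_add_iff 1).mpr ht
  have hdsum : Summable d := (summable_nat_add_iff 1).mp (ht.sub ht')
  have htot : HasSum d 1 := by
    rw [← hasSum_nat_add_iff' 1]
    convert! ht.hasSum.sub ((hasSum_nat_add_iff' 1).mpr ht.hasSum) using 1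
    simp [hd0]
  have hKt : ∀ k, Summable fun n => t n * poolKernel δ r (n + 1) k := fun k =>
    ht.abs.of_norm_bounded fun n => by
      rw [Real.norm_eq_abs, abs_mul, abs_of_nonneg (poolKernel_nonneg hδ0 hδ1 hr _ _)]
      exact mul_le_of_le_one_right (abs_nonneg _) (poolKernel_le_one hδ0 hδ1 hr _ _)
  have hKt' : ∀ k, Summable fun n => t (n + 1) * poolKernel δ r (n + 1) k := fun k =>
    ht'.abs.of_norm_bounded fun n => by
      rw [Real.norm_eq_abs, abs_mul, abs_of_nonneg (poolKernel_nonneg hδ0 hδ1 hr _ _)]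
      exact mul_le_of_le_one_right (abs_nonneg _) (poolKernel_le_one hδ0 hδ1 hr _ _)
  have hpois : ∀ k, poolKernel 1 r 1 k = poolKernel δ r 1 k := fun k => by
    rw [poolKernel_one_left, poolKernel_one_left]
  -- summation by parts
  have hparts : ∀ k s, HasSum (fun n => t (n + 1) * (poolKernel δ r (n + 2) k -
      poolKernel δ r (n + 1) k)) s →
      HasSum (fun n => d n * poolKernel δ r n k) (poolKernel δ r 1 k + s) := by
    intro k s hs
    rw [← hasSum_nat_add_iff' 1]
    have h1 := ((hasSum_nat_add_iff' 1).mpr (hKt k).hasSum).sub (hKt' k).hasSum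
    have h2 : s = _ := hs.unique <| by
      convert! h1 using 1
      funext n
      ring
    convert! (hKt k).hasSum.sub (hKt' k).hasSum using 1
    · funext n
      rw [hds]
      ring
    · rw [h2]
      simp only [Finset.sum_range_one, hd0, poolKernel_zero_left]
      ring
  refine ⟨_, isStationary_abs_div hδ0 hδ1 hr hdsum (fun k => ?_) ?_⟩
  · cases k with
    | zero =>
      convert! hparts 0 (-(t 0 - poissonTail r 0)) ?_ using 1
      · simp only [hd0, poissonTail, zero_add, Finset.sum_range_one, hpois]
        ring
      · convert! (hrec 0).neg using 1
        funext n
        rw [poolKernel_succ_zero]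
        ring
    | succ k =>
      convert! hparts (k + 1) ((t k - poissonTail r k) - (t (k + 1) - poissonTail r (k + 1))) ?_
        using 1
      · rw [hds, poissonTail, poissonTail, Finset.sum_range_succ _ (k + 1), hpois]
        ring
      · convert! (hrec k).sub (hrec (k + 1)) using 1
        funext n
        rw [poolKernel_succ_succ]
        ring
  · by_contra! h
    have h0 : d = fun _ => 0 := funext h
    exact zero_ne_one (hasSum_zero.unique (h0 ▸ htot))

end Existence

/-! ### The stationary probability of an empty pool -/

section EmptyPool

variable {δ r : ℝ} {p : ℕ → ℝ}

/-- The functional equation of the generating function of a stationary distribution. -/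
theorem IsStationary.tsum_mul_pow (hδ0 : 0 < δ) (hδ1 : δ ≤ 1) (hr : 0 ≤ r)
    (hp : IsStationary δ r p) {z : ℝ} (hz0 : 0 ≤ z) (hz1 : z ≤ 1) :
    (∑' n, p n * z ^ n) * (δ + (1 - δ) * z) = Real.exp (r * (z - 1)) *
      ((∑' n, p n * (δ + (1 - δ) * z) ^ n) - p 0 * (1 - (δ + (1 - δ) * z))) := by
  set u := δ + (1 - δ) * z with hu
  have hq : 0 ≤ 1 - δ := by linarith
  have hu0 : 0 ≤ u := by positivity
  have hu1 : u ≤ 1 := by nlinarith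
  have hK := poolKernel_nonneg hδ0 hδ1 hr
  have hpow : ∀ {x : ℝ}, 0 ≤ x → x ≤ 1 → ∀ m : ℕ → ℕ, Summable fun n => p n * x ^ m n :=
    fun hx0 hx1 m => hp.hasSum_one.summable.of_nonneg_of_le
      (fun n => mul_nonneg (hp.nonneg n) (pow_nonneg hx0 _))
      fun n => mul_le_of_le_one_right (hp.nonneg n) (pow_le_one₀ hx0 hx1)
  set E := Real.exp (r * (z - 1))
  have hrow : ∀ n, HasSum (fun k => p n * (poolKernel δ r n k * z ^ k)) (p n * u ^ (n - 1) * E) :=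
    fun n => by
      rw [mul_assoc]
      exact (hasSum_poolKernel_mul_pow δ r n z).mul_left _
  have hrows := (hpow hu0 hu1 fun n => n - 1).mul_right E
  have hprod : Summable fun x : ℕ × ℕ => p x.1 * (poolKernel δ r x.1 x.2 * z ^ x.2) := by
    refine (summable_prod_of_nonneg fun x => ?_).mpr ⟨fun n => (hrow n).summable, ?_⟩
    · exact mul_nonneg (hp.nonneg _) (mul_nonneg (hK _ _) (pow_nonneg hz0 _))
    · simpa only [(hrow _).tsum_eq] using hrows
  have h1 : ∑' n, p n * z ^ n = (∑' n, p n * u ^ (n - 1)) * E := by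
    rw [← tsum_mul_right]
    calc ∑' n, p n * z ^ n = ∑' k, ∑' n, p n * (poolKernel δ r n k * z ^ k) := by
          refine tsum_congr fun k => ?_
          rw [← (hp.invariant k).tsum_eq, ← tsum_mul_right]
          exact tsum_congr fun n => by ring
      _ = ∑' n, ∑' k, p n * (poolKernel δ r n k * z ^ k) := Summable.tsum_comm hprod
      _ = _ := tsum_congr fun n => (hrow n).tsum_eq
  have h2 : (∑' n, p n * u ^ (n - 1)) * u = (∑' n, p n * u ^ n) - p 0 * (1 - u) := by
    have ha := hpow hu0 hu1 fun n => n - 1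
    have hb := hpow hu0 hu1 fun n => n
    rw [ha.tsum_eq_zero_add, hb.tsum_eq_zero_add, add_mul, ← tsum_mul_right]
    simp only [Nat.add_sub_cancel, pow_succ, ← mul_assoc]
    simp
    ring
  rw [h1, mul_right_comm, h2, mul_comm]

/-- Approximations of the reciprocal of the stationary probability of an empty pool, as functions
of the mean number of arrivals. -/
noncomputable def emptyRecipSeq (δ : ℝ) : ℕ → ℝ → ℝ
  | 0, r => Real.exp (r / δ)
  | n + 1, r => (1 - (1 - δ) ^ (n + 1)) * emptyRecipSeq δ n r +
      (1 - δ) ^ (n + 1) * Real.exp (r / δ * (1 - δ) ^ (n + 1))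

/-- The points `1 - (1 - δ)^J` are the orbit of `0` under `z ↦ δ + (1 - δ) z`. Multiplying `G z` by
`exp (r (1 - z) / δ)` absorbs the exponential of the functional equation, so each step becomes a
convex combination. -/
theorem IsStationary.mul_emptyRecipSeq (hδ0 : 0 < δ) (hδ1 : δ ≤ 1) (hr : 0 ≤ r)
    (hp : IsStationary δ r p) (J : ℕ) :
    p 0 * emptyRecipSeq δ J r =
      (∑' n, p n * (1 - (1 - δ) ^ J) ^ n) * Real.exp (r / δ * (1 - δ) ^ J) := by
  have hq0 : 0 ≤ 1 - δ := by linarith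
  have hq1 : 1 - δ ≤ 1 := by linarith
  induction J with
  | zero =>
    have : ∑' n, p n * (1 - (1 - δ) ^ 0) ^ n = p 0 := by
      rw [tsum_eq_single 0 fun n hn => by simp [hn]]
      simp
    rw [this]
    simp [emptyRecipSeq]
  | succ J ih =>
    have h := hp.tsum_mul_pow hδ0 hδ1 hr (z := 1 - (1 - δ) ^ J)
      (sub_nonneg.mpr (pow_le_one₀ hq0 hq1)) (sub_le_self _ (pow_nonneg hq0 _))
    have hu : δ + (1 - δ) * (1 - (1 - δ) ^ J) = 1 - (1 - δ) ^ (J + 1) := by ring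
    rw [hu] at h
    have hexp : Real.exp (r * (1 - (1 - δ) ^ J - 1)) * Real.exp (r / δ * (1 - δ) ^ J) =
        Real.exp (r / δ * (1 - δ) ^ (J + 1)) := by
      rw [← Real.exp_add]
      congr 1
      field_simp
      ring
    simp only [emptyRecipSeq]
    rw [← hexp] at *
    linear_combination (1 - (1 - δ) ^ (J + 1)) * ih + h * Real.exp (r / δ * (1 - δ) ^ J)

theorem IsStationary.tendsto_mul_emptyRecipSeq (hδ0 : 0 < δ) (hδ1 : δ ≤ 1) (hr : 0 ≤ r)
    (hp : IsStationary δ r p) :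
    Tendsto (fun J => p 0 * emptyRecipSeq δ J r) atTop (𝓝 1) := by
  have hq0 : 0 ≤ 1 - δ := by linarith
  have hq1 : 1 - δ < 1 := by linarith
  have hq : Tendsto (fun J : ℕ => (1 - δ) ^ J) atTop (𝓝 0) :=
    tendsto_pow_atTop_nhds_zero_of_lt_one hq0 hq1
  simp only [hp.mul_emptyRecipSeq hδ0 hδ1 hr]
  have h1 : Tendsto (fun J : ℕ => ∑' n, p n * (1 - (1 - δ) ^ J) ^ n) atTop (𝓝 (∑' n, p n)) := by
    refine tendsto_tsum_of_dominated_convergence hp.hasSum_one.summable (fun n => ?_)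
      (Eventually.of_forall fun J n => ?_)
    · simpa using ((hq.const_sub 1).pow n).const_mul (p n)
    · have h0 : 0 ≤ 1 - (1 - δ) ^ J := sub_nonneg.mpr (pow_le_one₀ hq0 hq1.le)
      rw [Real.norm_eq_abs, abs_of_nonneg (mul_nonneg (hp.nonneg n) (pow_nonneg h0 n))]
      exact mul_le_of_le_one_right (hp.nonneg n)
        (pow_le_one₀ h0 (sub_le_self _ (pow_nonneg hq0 _)))
  have h2 : Tendsto (fun J : ℕ => Real.exp (r / δ * (1 - δ) ^ J)) atTop (𝓝 1) := by
    simpa [Function.comp_def] using (Real.continuous_exp.tendsto _).comp (hq.const_mul (r / δ))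
  simpa [hp.hasSum_one.tsum_eq] using h1.mul h2

theorem IsStationary.pos (hδ0 : 0 < δ) (hδ1 : δ ≤ 1) (hr : 0 ≤ r) (hp : IsStationary δ r p) :
    0 < p 0 := by
  refine (hp.nonneg 0).lt_of_ne fun h => ?_
  have := hp.tendsto_mul_emptyRecipSeq hδ0 hδ1 hr
  simp [← h] at this

theorem IsStationary.tendsto_emptyRecipSeq (hδ0 : 0 < δ) (hδ1 : δ ≤ 1) (hr : 0 ≤ r)
    (hp : IsStationary δ r p) :
    Tendsto (fun J => emptyRecipSeq δ J r) atTop (𝓝 (p 0)⁻¹) := by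
  have h0 := (hp.pos hδ0 hδ1 hr).ne'
  simpa [h0] using (hp.tendsto_mul_emptyRecipSeq hδ0 hδ1 hr).const_mul (p 0)⁻¹

/-- Two stationary laws agree at `0`. If they differed, their normalized absolute difference would
be a stationary law vanishing at `0`, against `IsStationary.pos`. -/
theorem existsUnique_isStationary (hδ0 : 0 < δ) (hδ1 : δ ≤ 1) (hr : 0 ≤ r) :
    ∃! p, IsStationary δ r p := by
  obtain ⟨p, hp⟩ := exists_isStationary hδ0 hδ1 hr
  refine ⟨p, hp, fun p' hp' => ?_⟩
  by_contra! hne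
  have h0 : p' 0 = p 0 := inv_injective <|
    tendsto_nhds_unique (hp'.tendsto_emptyRecipSeq hδ0 hδ1 hr) (hp.tendsto_emptyRecipSeq hδ0 hδ1 hr)
  have hst := isStationary_abs_div hδ0 hδ1 hr (d := fun n => p' n - p n)
    (hp'.hasSum_one.summable.sub hp.hasSum_one.summable)
    (fun k => by simpa only [sub_mul] using (hp'.invariant k).sub (hp.invariant k))
    (by
      obtain ⟨n, hn⟩ := Function.ne_iff.mp hne
      exact ⟨n, sub_ne_zero.mpr hn⟩)
  have := hst.pos hδ0 hδ1 hr
  simp [h0] at this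

theorem exists_isStationary_emptyProb (hδ0 : 0 < δ) (hδ1 : δ ≤ 1) (hr : 0 ≤ r) :
    ∃ p, IsStationary δ r p ∧ p 0 = emptyProb δ r := by
  have h := exists_isStationary hδ0 hδ1 hr
  exact ⟨h.choose, h.choose_spec, by rw [emptyProb, dif_pos h]⟩

theorem emptyProb_pos (hδ0 : 0 < δ) (hδ1 : δ ≤ 1) (hr : 0 ≤ r) : 0 < emptyProb δ r := by
  obtain ⟨p, hp, h⟩ := exists_isStationary_emptyProb hδ0 hδ1 hr
  exact h ▸ hp.pos hδ0 hδ1 hr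

theorem emptyProb_le_one (hδ0 : 0 < δ) (hδ1 : δ ≤ 1) (hr : 0 ≤ r) : emptyProb δ r ≤ 1 := by
  obtain ⟨p, hp, h⟩ := exists_isStationary_emptyProb hδ0 hδ1 hr
  exact h ▸ le_hasSum hp.hasSum_one 0 fun j _ => hp.nonneg j

theorem tendsto_emptyRecipSeq (hδ0 : 0 < δ) (hδ1 : δ ≤ 1) (hr : 0 ≤ r) :
    Tendsto (fun J => emptyRecipSeq δ J r) atTop (𝓝 (emptyProb δ r)⁻¹) := by
  obtain ⟨p, hp, h⟩ := exists_isStationary_emptyProb hδ0 hδ1 hr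
  exact h ▸ hp.tendsto_emptyRecipSeq hδ0 hδ1 hr

theorem emptyRecipSeq_mono (hδ0 : 0 < δ) (hδ1 : δ ≤ 1) (J : ℕ) : Monotone (emptyRecipSeq δ J) := by
  have hq0 : 0 ≤ 1 - δ := by linarith
  have hq1 : 1 - δ ≤ 1 := by linarith
  induction J with
  | zero =>
    intro r s h
    simp only [emptyRecipSeq]
    gcongr
  | succ J ih =>
    intro r s h
    have : 0 ≤ 1 - (1 - δ) ^ (J + 1) := sub_nonneg.mpr (pow_le_one₀ hq0 hq1)
    simp only [emptyRecipSeq]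
    gcongr
    exact ih h

theorem emptyProb_antitoneOn (hδ0 : 0 < δ) (hδ1 : δ ≤ 1) : AntitoneOn (emptyProb δ) (Ici 0) := by
  intro r hr s hs h
  have := le_of_tendsto_of_tendsto' (tendsto_emptyRecipSeq hδ0 hδ1 hr)
    (tendsto_emptyRecipSeq hδ0 hδ1 hs) fun J => emptyRecipSeq_mono hδ0 hδ1 J h
  exact (inv_le_inv₀ (emptyProb_pos hδ0 hδ1 hr) (emptyProb_pos hδ0 hδ1 hs)).mp this

/-- The complex extension of `emptyRecipSeq`. -/
noncomputable def emptyRecipSeqC (δ : ℝ) : ℕ → ℂ → ℂ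
  | 0, z => Complex.exp (z / δ)
  | n + 1, z => (1 - (1 - δ : ℂ) ^ (n + 1)) * emptyRecipSeqC δ n z +
      (1 - δ : ℂ) ^ (n + 1) * Complex.exp (z / δ * (1 - δ : ℂ) ^ (n + 1))

theorem emptyRecipSeqC_ofReal (δ r : ℝ) (J : ℕ) :
    emptyRecipSeqC δ J r = (emptyRecipSeq δ J r : ℂ) := by
  induction J with
  | zero => simp [emptyRecipSeqC, emptyRecipSeq]
  | succ J ih => simp [emptyRecipSeqC, emptyRecipSeq, ih]

theorem differentiable_emptyRecipSeqC (δ : ℝ) (J : ℕ) : Differentiable ℂ (emptyRecipSeqC δ J) := by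
  induction J with
  | zero =>
    have h : emptyRecipSeqC δ 0 = fun z => Complex.exp (z / δ) := rfl
    rw [h]
    fun_prop
  | succ J ih =>
    have h : emptyRecipSeqC δ (J + 1) = fun z =>
      (1 - (1 - δ : ℂ) ^ (J + 1)) * emptyRecipSeqC δ J z +
      (1 - δ : ℂ) ^ (J + 1) * Complex.exp (z / δ * (1 - δ : ℂ) ^ (J + 1)) := rfl
    rw [h]
    fun_prop

theorem norm_exp_div_mul_le (hδ0 : 0 < δ) (hδ1 : δ ≤ 1) {R : ℝ} {z : ℂ} (hz : ‖z‖ ≤ R) (J : ℕ) :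
    ‖Complex.exp (z / δ * (1 - δ : ℂ) ^ J)‖ ≤ Real.exp (R / δ) := by
  have hq0 : 0 ≤ 1 - δ := by linarith
  refine (Complex.norm_exp_le_exp_norm _).trans (Real.exp_le_exp.mpr ?_)
  have h1 : ‖(1 - δ : ℂ)‖ ≤ 1 := by
    rw [← Complex.ofReal_one, ← Complex.ofReal_sub, Complex.norm_real, Real.norm_eq_abs,
      abs_of_nonneg hq0]
    linarith
  rw [norm_mul, norm_div, Complex.norm_real, Real.norm_eq_abs, abs_of_pos hδ0, norm_pow]
  exact (mul_le_of_le_one_right (by positivity) (pow_le_one₀ (norm_nonneg _) h1)).trans (by gcongr)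

theorem norm_emptyRecipSeqC_le (hδ0 : 0 < δ) (hδ1 : δ ≤ 1) {R : ℝ} {z : ℂ} (hz : ‖z‖ ≤ R)
    (J : ℕ) : ‖emptyRecipSeqC δ J z‖ ≤ Real.exp (R / δ) := by
  have hq0 : 0 ≤ 1 - δ := by linarith
  have hq1 : 1 - δ ≤ 1 := by linarith
  induction J with
  | zero => simpa [emptyRecipSeqC] using norm_exp_div_mul_le hδ0 hδ1 hz 0
  | succ J ih =>
    have ha0 : 0 ≤ (1 - δ) ^ (J + 1) := pow_nonneg hq0 _
    have ha1 : 0 ≤ 1 - (1 - δ) ^ (J + 1) := sub_nonneg.mpr (pow_le_one₀ hq0 hq1)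
    have h1 : ‖(1 - (1 - δ : ℂ) ^ (J + 1))‖ = 1 - (1 - δ) ^ (J + 1) := by
      rw [← abs_of_nonneg ha1, ← Real.norm_eq_abs, ← Complex.norm_real]
      push_cast
      rfl
    have h2 : ‖(1 - δ : ℂ) ^ (J + 1)‖ = (1 - δ) ^ (J + 1) := by
      rw [← abs_of_nonneg ha0, ← Real.norm_eq_abs, ← Complex.norm_real]
      push_cast
      rfl
    refine (norm_add_le _ _).trans ?_
    rw [norm_mul, norm_mul, h1, h2]
    have := norm_exp_div_mul_le hδ0 hδ1 hz (J + 1)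
    nlinarith

/-- The reciprocal of the stationary probability of an empty pool extends to a smooth function. -/
theorem exists_contDiff_emptyProb (hδ0 : 0 < δ) (hδ1 : δ ≤ 1) :
    ∃ Q : ℝ → ℝ, ContDiff ℝ 1 Q ∧ ∀ r, 0 ≤ r → Q r = (emptyProb δ r)⁻¹ := by
  have hq0 : 0 ≤ 1 - δ := by linarith
  have hq1 : 1 - δ < 1 := by linarith
  -- The limit is written as a telescoping series. Over `ℂ`, geometric bounds on discs give
  -- differentiability of the sum without any estimate of derivatives.
  set D : ℕ → ℂ → ℂ := fun J z => emptyRecipSeqC δ (J + 1) z - emptyRecipSeqC δ J z with hD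
  set H : ℂ → ℂ := fun z => emptyRecipSeqC δ 0 z + ∑' J, D J z with hH
  have hbound : ∀ R : ℝ, ∀ J, ∀ z : ℂ, ‖z‖ ≤ R →
      ‖D J z‖ ≤ (2 * Real.exp (R / δ)) * (1 - δ) ^ (J + 1) := by
    intro R J z hz
    have h1 : D J z = (1 - δ : ℂ) ^ (J + 1) *
        (Complex.exp (z / δ * (1 - δ : ℂ) ^ (J + 1)) - emptyRecipSeqC δ J z) := by
      simp only [hD, emptyRecipSeqC]
      ring
    have h2 : ‖(1 - δ : ℂ) ^ (J + 1)‖ = (1 - δ) ^ (J + 1) := by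
      rw [← abs_of_nonneg (pow_nonneg hq0 (J + 1)), ← Real.norm_eq_abs, ← Complex.norm_real]
      push_cast
      rfl
    rw [h1, norm_mul, h2, mul_comm]
    gcongr
    refine (norm_sub_le _ _).trans ?_
    linarith [norm_exp_div_mul_le hδ0 hδ1 hz (J + 1), norm_emptyRecipSeqC_le hδ0 hδ1 hz J]
  have hgeom : ∀ R : ℝ, Summable fun J : ℕ => (2 * Real.exp (R / δ)) * (1 - δ) ^ (J + 1) :=
    fun R => ((summable_nat_add_iff 1).mpr (summable_geometric_of_lt_one hq0 hq1)).mul_left _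
  have hdiff : Differentiable ℂ H := by
    refine (differentiable_emptyRecipSeqC δ 0).add fun z => ?_
    have h1 : DifferentiableOn ℂ (fun w => ∑' J, D J w) (Metric.ball 0 (‖z‖ + 1)) :=
      Complex.differentiableOn_tsum_of_summable_norm (hgeom (‖z‖ + 1))
        (fun J => ((differentiable_emptyRecipSeqC δ (J + 1)).sub
          (differentiable_emptyRecipSeqC δ J)).differentiableOn) Metric.isOpen_ball
        fun J w hw => hbound _ J w (mem_ball_zero_iff.mp hw).le
    exact h1.differentiableAt (Metric.isOpen_ball.mem_nhds (by simp))
  refine ⟨fun x => (H x).re, hdiff.contDiff.real_of_complex, fun r hr => ?_⟩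
  have hsum : Summable fun J => D J r :=
    (hgeom ‖(r : ℂ)‖).of_norm_bounded fun J => hbound _ J _ le_rfl
  have hlim : Tendsto (fun J => emptyRecipSeqC δ J r) atTop (𝓝 (H r)) := by
    have := hsum.hasSum.tendsto_sum_nat.const_add (emptyRecipSeqC δ 0 r)
    refine this.congr fun J => ?_
    simp only [hD]
    rw [Finset.sum_range_sub fun J => emptyRecipSeqC δ J r]
    ring
  simp only [emptyRecipSeqC_ofReal] at hlim
  exact tendsto_nhds_unique ((Complex.continuous_re.tendsto _).comp hlim)
    (tendsto_emptyRecipSeq hδ0 hδ1 hr)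

end EmptyPool

/-! ### The winner distribution -/

section Winner

variable {δ lam : ℝ}

theorem mul_one_sub_nonneg (hlam : 0 ≤ lam) {g : ℝ} (hg : g ∈ Icc (0 : ℝ) 1) :
    0 ≤ lam * (1 - g) :=
  mul_nonneg hlam (sub_nonneg.mpr hg.2)

theorem winnerCDF_pos (hδ0 : 0 < δ) (hδ1 : δ ≤ 1) (hlam : 0 ≤ lam) {g : ℝ}
    (hg : g ∈ Icc (0 : ℝ) 1) : 0 < winnerCDF δ lam g :=
  emptyProb_pos hδ0 hδ1 (mul_one_sub_nonneg hlam hg)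

theorem winnerCDF_le_one (hδ0 : 0 < δ) (hδ1 : δ ≤ 1) (hlam : 0 ≤ lam) {g : ℝ}
    (hg : g ∈ Icc (0 : ℝ) 1) : winnerCDF δ lam g ≤ 1 :=
  emptyProb_le_one hδ0 hδ1 (mul_one_sub_nonneg hlam hg)

theorem monotoneOn_winnerCDF (hδ0 : 0 < δ) (hδ1 : δ ≤ 1) (hlam : 0 ≤ lam) :
    MonotoneOn (winnerCDF δ lam) (Icc 0 1) := fun g hg h hh hgh =>
  emptyProb_antitoneOn hδ0 hδ1 (mul_one_sub_nonneg hlam hh) (mul_one_sub_nonneg hlam hg)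
    (mul_le_mul_of_nonneg_left (by linarith) hlam)

theorem contDiffOn_winnerCDF (hδ0 : 0 < δ) (hδ1 : δ ≤ 1) (hlam : 0 ≤ lam) :
    ContDiffOn ℝ 1 (winnerCDF δ lam) (Icc 0 1) := by
  obtain ⟨Q, hQ, hQe⟩ := exists_contDiff_emptyProb hδ0 hδ1
  have h1 : ContDiff ℝ 1 fun g : ℝ => Q (lam * (1 - g)) := hQ.comp (by fun_prop)
  have h2 : ∀ g ∈ Icc (0 : ℝ) 1, Q (lam * (1 - g)) = (winnerCDF δ lam g)⁻¹ := fun g hg =>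
    hQe _ (mul_one_sub_nonneg hlam hg)
  refine (h1.contDiffOn.inv fun g hg => ?_).congr fun g hg => ?_
  · rw [h2 g hg]
    exact (inv_pos.mpr (winnerCDF_pos hδ0 hδ1 hlam hg)).ne'
  · rw [Pi.inv_apply, h2 g hg, inv_inv]

theorem hasDerivWithinAt_winnerCDF (hδ0 : 0 < δ) (hδ1 : δ ≤ 1) (hlam : 0 ≤ lam) {g : ℝ}
    (hg : g ∈ Icc (0 : ℝ) 1) :
    HasDerivWithinAt (winnerCDF δ lam) (winnerDensity δ lam g) (Icc 0 1) g :=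
  ((contDiffOn_winnerCDF hδ0 hδ1 hlam).differentiableOn one_ne_zero g hg).hasDerivWithinAt

theorem continuousOn_winnerDensity (hδ0 : 0 < δ) (hδ1 : δ ≤ 1) (hlam : 0 ≤ lam) :
    ContinuousOn (winnerDensity δ lam) (Icc 0 1) :=
  (contDiffOn_winnerCDF hδ0 hδ1 hlam).continuousOn_derivWithin (uniqueDiffOn_Icc one_pos) le_rfl

theorem winnerDensity_nonneg (hδ0 : 0 < δ) (hδ1 : δ ≤ 1) (hlam : 0 ≤ lam) (g : ℝ) :
    0 ≤ winnerDensity δ lam g :=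
  (monotoneOn_winnerCDF hδ0 hδ1 hlam).derivWithin_nonneg

/-- The payoff per unit of surplus of a bidder who wins each round with the probability `W g`,
up to the constant factor `δ`. -/
noncomputable def bidWeight (δ lam g : ℝ) : ℝ :=
  winnerCDF δ lam g / (1 + (1 - δ) / δ * winnerCDF δ lam g)

/-- The derivative of `bidWeight`. -/
noncomputable def bidWeightDensity (δ lam g : ℝ) : ℝ :=
  winnerDensity δ lam g / (1 + (1 - δ) / δ * winnerCDF δ lam g) ^ 2

theorem one_add_mul_winnerCDF_pos (hδ0 : 0 < δ) (hδ1 : δ ≤ 1) (hlam : 0 ≤ lam) {g : ℝ}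
    (hg : g ∈ Icc (0 : ℝ) 1) : 0 < 1 + (1 - δ) / δ * winnerCDF δ lam g := by
  have h1 : 0 ≤ (1 - δ) / δ := div_nonneg (by linarith) hδ0.le
  have := winnerCDF_pos hδ0 hδ1 hlam hg
  positivity

theorem bidWeight_pos (hδ0 : 0 < δ) (hδ1 : δ ≤ 1) (hlam : 0 ≤ lam) {g : ℝ}
    (hg : g ∈ Icc (0 : ℝ) 1) : 0 < bidWeight δ lam g :=
  div_pos (winnerCDF_pos hδ0 hδ1 hlam hg) (one_add_mul_winnerCDF_pos hδ0 hδ1 hlam hg)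

theorem monotoneOn_bidWeight (hδ0 : 0 < δ) (hδ1 : δ ≤ 1) (hlam : 0 ≤ lam) :
    MonotoneOn (bidWeight δ lam) (Icc 0 1) := by
  intro g hg h hh hgh
  have := monotoneOn_winnerCDF hδ0 hδ1 hlam hg hh hgh
  rw [bidWeight, bidWeight, div_le_div_iff₀ (one_add_mul_winnerCDF_pos hδ0 hδ1 hlam hg)
    (one_add_mul_winnerCDF_pos hδ0 hδ1 hlam hh)]
  linarith

theorem hasDerivWithinAt_bidWeight (hδ0 : 0 < δ) (hδ1 : δ ≤ 1) (hlam : 0 ≤ lam) {g : ℝ}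
    (hg : g ∈ Icc (0 : ℝ) 1) :
    HasDerivWithinAt (bidWeight δ lam) (bidWeightDensity δ lam g) (Icc 0 1) g := by
  have hW := hasDerivWithinAt_winnerCDF hδ0 hδ1 hlam hg
  convert! hW.div ((hW.const_mul ((1 - δ) / δ)).const_add 1)
    (one_add_mul_winnerCDF_pos hδ0 hδ1 hlam hg).ne' using 1
  rw [bidWeightDensity]
  ring

theorem continuousOn_bidWeightDensity (hδ0 : 0 < δ) (hδ1 : δ ≤ 1) (hlam : 0 ≤ lam) :
    ContinuousOn (bidWeightDensity δ lam) (Icc 0 1) := by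
  refine (continuousOn_winnerDensity hδ0 hδ1 hlam).div ?_ fun g hg =>
    (pow_pos (one_add_mul_winnerCDF_pos hδ0 hδ1 hlam hg) 2).ne'
  exact (continuousOn_const.add (continuousOn_const.mul
    (contDiffOn_winnerCDF hδ0 hδ1 hlam).continuousOn)).pow 2

theorem bidWeightDensity_nonneg (hδ0 : 0 < δ) (hδ1 : δ ≤ 1) (hlam : 0 ≤ lam) (g : ℝ) :
    0 ≤ bidWeightDensity δ lam g :=
  div_nonneg (winnerDensity_nonneg hδ0 hδ1 hlam g) (sq_nonneg _)

theorem exists_lipschitzOnWith_bidWeight (hδ0 : 0 < δ) (hδ1 : δ ≤ 1) (hlam : 0 ≤ lam) :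
    ∃ K, LipschitzOnWith K (bidWeight δ lam) (Icc 0 1) := by
  obtain ⟨C, hC⟩ := isCompact_Icc.exists_bound_of_continuousOn
    (continuousOn_bidWeightDensity hδ0 hδ1 hlam)
  exact ⟨C.toNNReal, (convex_Icc 0 1).lipschitzOnWith_of_nnnorm_hasDerivWithin_le
    (fun g hg => hasDerivWithinAt_bidWeight hδ0 hδ1 hlam hg)
    fun g hg => NNReal.coe_le_coe.mp ((hC g hg).trans (Real.le_coe_toNNReal C))⟩

end Winner

/-! ### The value distribution -/

theorem _root_.LipschitzOnWith.comp_absolutelyContinuousOnInterval {X Y : Type*}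
    [PseudoMetricSpace X] [PseudoMetricSpace Y] {g : X → Y} {K : NNReal} {s : Set X} {f : ℝ → X}
    {a b : ℝ} (hg : LipschitzOnWith K g s) (hf : AbsolutelyContinuousOnInterval f a b)
    (hs : MapsTo f (uIcc a b) s) : AbsolutelyContinuousOnInterval (g ∘ f) a b := by
  refine squeeze_zero' (Eventually.of_forall fun E => Finset.sum_nonneg fun i _ => dist_nonneg) ?_
    (by simpa using Tendsto.const_mul (K : ℝ) hf)
  filter_upwards [mem_inf_of_right (mem_principal_self _)] with E hE
  rw [Finset.mul_sum]
  exact Finset.sum_le_sum fun i hi =>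
    hg.dist_le_mul _ (hs (hE.1 i hi).1) _ (hs (hE.1 i hi).2)

section Values

variable {f : ℝ → ℝ}

theorem valueCDF_mem_Icc (f : ℝ → ℝ) (x : ℝ) : valueCDF f x ∈ Icc (0 : ℝ) 1 :=
  ⟨ProbabilityTheory.cdf_nonneg _ x, ProbabilityTheory.cdf_le_one _ x⟩

theorem monotone_valueCDF (f : ℝ → ℝ) : Monotone (valueCDF f) := ProbabilityTheory.monotone_cdf _

theorem valueCDF_eq (hf1 : IsProbabilityMeasure (valueLaw f)) (x : ℝ) :
    valueCDF f x = (valueLaw f).real (Iic x) :=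
  ProbabilityTheory.cdf_eq_real _ x

theorem integrable_density (hf : Measurable f) (hf0 : ∀ x, 0 ≤ f x)
    (hf1 : IsProbabilityMeasure (valueLaw f)) : Integrable f := by
  rw [← lintegral_ofReal_ne_top_iff_integrable hf.aestronglyMeasurable (ae_of_all _ hf0)]
  have h : valueLaw f univ = 1 := measure_univ
  rw [valueLaw, withDensity_apply _ MeasurableSet.univ, Measure.restrict_univ] at h
  rw [h]
  exact ENNReal.one_ne_top

theorem valueCDF_eq_integral (hf : Measurable f) (hf0 : ∀ x, 0 ≤ f x)
    (hf1 : IsProbabilityMeasure (valueLaw f)) (x : ℝ) :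
    valueCDF f x = ∫ z in Iic x, f z := by
  rw [valueCDF_eq hf1, measureReal_def, valueLaw, withDensity_apply _ measurableSet_Iic,
    integral_eq_lintegral_of_nonneg_ae (ae_of_all _ hf0) hf.aestronglyMeasurable]

theorem valueCDF_eq_add (hf : Measurable f) (hf0 : ∀ x, 0 ≤ f x)
    (hf1 : IsProbabilityMeasure (valueLaw f)) (a x : ℝ) :
    valueCDF f x = valueCDF f a + ∫ z in a..x, f z := by
  have hi := integrable_density hf hf0 hf1
  rw [valueCDF_eq_integral hf hf0 hf1, valueCDF_eq_integral hf hf0 hf1,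
    ← intervalIntegral.integral_Iic_sub_Iic hi.integrableOn hi.integrableOn]
  ring

theorem hasDerivAt_valueCDF_of_integral (hf : Measurable f) (hf0 : ∀ x, 0 ≤ f x)
    (hf1 : IsProbabilityMeasure (valueLaw f)) {a x : ℝ}
    (h : HasDerivAt (fun y => ∫ z in a..y, f z) (f x) x) : HasDerivAt (valueCDF f) (f x) x := by
  have := h.const_add (valueCDF f a)
  rwa [← funext (valueCDF_eq_add hf hf0 hf1 a)] at this

theorem absolutelyContinuousOnInterval_valueCDF (hf : Measurable f) (hf0 : ∀ x, 0 ≤ f x)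
    (hf1 : IsProbabilityMeasure (valueLaw f)) (a b : ℝ) :
    AbsolutelyContinuousOnInterval (valueCDF f) a b := by
  have h := (integrable_density hf hf0 hf1).intervalIntegrable (a := a) (b := b)
    |>.absolutelyContinuousOnInterval_intervalIntegral left_mem_uIcc
  rw [absolutelyContinuousOnInterval_iff] at h ⊢
  have hd : ∀ x y, dist (valueCDF f x) (valueCDF f y) =
      dist (∫ z in a..x, f z) (∫ z in a..y, f z) := fun x y => by
    rw [valueCDF_eq_add hf hf0 hf1 a x, valueCDF_eq_add hf hf0 hf1 a y, dist_add_left]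
  simpa only [hd] using h

theorem continuous_valueCDF (hf : Measurable f) (hf0 : ∀ x, 0 ≤ f x)
    (hf1 : IsProbabilityMeasure (valueLaw f)) : Continuous (valueCDF f) := by
  rw [funext (valueCDF_eq_add hf hf0 hf1 0)]
  exact continuous_const.add
    (intervalIntegral.continuous_primitive
      (fun _ _ => (integrable_density hf hf0 hf1).intervalIntegrable) 0)

theorem valueLaw_real_Ioi (hf1 : IsProbabilityMeasure (valueLaw f)) (x : ℝ) :
    (valueLaw f).real (Ioi x) = 1 - valueCDF f x := by
  rw [valueCDF_eq hf1, ← compl_Iic, probReal_compl_eq_one_sub measurableSet_Iic]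

instance (f : ℝ → ℝ) : NullSingletonClass (valueLaw f) := by
  unfold valueLaw
  infer_instance

theorem valueLaw_ae_mem_support (f : ℝ → ℝ) : ∀ᵐ x ∂valueLaw f, x ∈ (valueLaw f).support :=
  Measure.measure_compl_support

theorem support_subset_Ici (hneg : valueLaw f (Iio 0) = 0) : (valueLaw f).support ⊆ Ici 0 :=
  Measure.support_subset_of_isClosed isClosed_Ici (by simpa [mem_ae_iff] using hneg)

theorem lowestValue_mem_support (hf1 : IsProbabilityMeasure (valueLaw f))
    (hneg : valueLaw f (Iio 0) = 0) : lowestValue f ∈ (valueLaw f).support :=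
  Measure.isClosed_support.csInf_mem (Measure.nonempty_support hf1.ne_zero)
    ⟨0, fun _ hx => support_subset_Ici hneg hx⟩

theorem lowestValue_nonneg (hf1 : IsProbabilityMeasure (valueLaw f))
    (hneg : valueLaw f (Iio 0) = 0) : 0 ≤ lowestValue f :=
  support_subset_Ici hneg (lowestValue_mem_support hf1 hneg)

theorem lowestValue_le (hneg : valueLaw f (Iio 0) = 0) {x : ℝ} (hx : x ∈ (valueLaw f).support) :
    lowestValue f ≤ x :=
  csInf_le ⟨0, fun _ hx => support_subset_Ici hneg hx⟩ hx

theorem valueCDF_lowestValue (hf1 : IsProbabilityMeasure (valueLaw f))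
    (hneg : valueLaw f (Iio 0) = 0) : valueCDF f (lowestValue f) = 0 := by
  rw [valueCDF_eq hf1, measureReal_def, measure_congr Iio_ae_eq_Iic.symm]
  have : valueLaw f (Iio (lowestValue f)) = 0 := measure_mono_null
    (t := (valueLaw f).supportᶜ)
    (fun x hx hxs => (not_le.mpr hx) (lowestValue_le hneg hxs)) Measure.measure_compl_support
  simp [this]

/-- The fundamental theorem of calculus for a continuously differentiable function of the c.d.f. -/
theorem integral_comp_valueCDF (hf : Measurable f) (hf0 : ∀ x, 0 ≤ f x)
    (hf1 : IsProbabilityMeasure (valueLaw f)) {Ψ ψ : ℝ → ℝ}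
    (hΨ : ∀ g ∈ Icc (0 : ℝ) 1, HasDerivWithinAt Ψ (ψ g) (Icc 0 1) g)
    (hψ : ContinuousOn ψ (Icc 0 1)) {K : NNReal} (hK : LipschitzOnWith K Ψ (Icc 0 1)) (a b : ℝ) :
    ∫ z in a..b, ψ (valueCDF f z) * f z = Ψ (valueCDF f b) - Ψ (valueCDF f a) := by
  have hFc := continuous_valueCDF hf hf0 hf1
  have hψF : Continuous fun z => ψ (valueCDF f z) :=
    hψ.comp_continuous hFc (valueCDF_mem_Icc f)
  have hfi := integrable_density hf hf0 hf1
  have hloc : LocallyIntegrable fun z => ψ (valueCDF f z) * f z :=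
    hfi.locallyIntegrable.continuous_mul hψF
  have hint : IntervalIntegrable (fun z => ψ (valueCDF f z) * f z) volume a b :=
    hfi.intervalIntegrable.continuousOn_mul hψF.continuousOn
  -- Since `f` is only integrable, `F` is differentiable merely almost everywhere. A Lipschitz
  -- function of the absolutely continuous `F` is absolutely continuous, and an absolutely
  -- continuous function with zero derivative almost everywhere is constant.
  have hac := (hK.comp_absolutelyContinuousOnInterval
    (absolutelyContinuousOnInterval_valueCDF hf hf0 hf1 a b)
    fun x _ => valueCDF_mem_Icc f x).fun_sub
      (hint.absolutelyContinuousOnInterval_intervalIntegral left_mem_uIcc)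
  have hderiv : ∀ᵐ x, x ∈ uIcc a b → HasDerivAt (fun x => (Ψ ∘ valueCDF f) x -
      ∫ z in a..x, ψ (valueCDF f z) * f z) 0 x := by
    filter_upwards [LocallyIntegrable.ae_hasDerivAt_integral hfi.locallyIntegrable,
      LocallyIntegrable.ae_hasDerivAt_integral hloc]
      with x hx1 hx2 _
    have h1 := (hΨ _ (valueCDF_mem_Icc f x)).comp_hasDerivAt x
      (hasDerivAt_valueCDF_of_integral hf hf0 hf1 (hx1 a))
      (Eventually.of_forall (valueCDF_mem_Icc f))
    have h2 := h1.sub (hx2 a)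
    rw [sub_self] at h2
    exact h2
  obtain ⟨C, hC⟩ := hac.const_of_ae_hasDerivAt_zero hderiv
  have ha := hC a left_mem_uIcc
  have hb := hC b right_mem_uIcc
  simp only [Function.comp_apply, intervalIntegral.integral_same] at ha hb
  linarith

end Values

/-! ### Payoffs -/

section Payoff

variable {δ lam : ℝ} {f b : ℝ → ℝ}

/-- The competitors who beat a bidder of value `x` with the bid `β`. -/
def beatingSet (b : ℝ → ℝ) (x β : ℝ) : Set ℝ := {z | β < b z ∨ (b z = β ∧ x < z)}

/-- The outer probability that a single competitor does not beat a bidder of value `x` with the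
bid `β`. -/
noncomputable def percentile (f b : ℝ → ℝ) (x β : ℝ) : ℝ :=
  1 - (valueLaw f).real (beatingSet b x β)

theorem one_sub_measureReal_mem_Icc (hf1 : IsProbabilityMeasure (valueLaw f)) (A : Set ℝ) :
    1 - (valueLaw f).real A ∈ Icc (0 : ℝ) 1 :=
  ⟨sub_nonneg.mpr measureReal_le_one, sub_le_self _ measureReal_nonneg⟩

theorem percentile_mem_Icc (hf1 : IsProbabilityMeasure (valueLaw f)) (b : ℝ → ℝ) (x β : ℝ) :
    percentile f b x β ∈ Icc (0 : ℝ) 1 :=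
  one_sub_measureReal_mem_Icc hf1 _

/-- Lets `W` and `bidWeight` describe every bid; `b` is arbitrary, so the beating set may be
nonmeasurable and only its outer measure enters. -/
theorem winProb_eq (δ lam : ℝ) (f b : ℝ → ℝ) (x β : ℝ) :
    winProb δ lam f b x β = winnerCDF δ lam (percentile f b x β) := by
  rw [winProb, winnerCDF, percentile, sub_sub_cancel]
  rfl

theorem payoff_const (hδ0 : 0 < δ) (hδ1 : δ ≤ 1) (hlam : 0 ≤ lam)
    (hf1 : IsProbabilityMeasure (valueLaw f)) (b : ℝ → ℝ) (x β : ℝ) :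
    payoff δ lam f b x (fun _ => β) = (x - β) * bidWeight δ lam (percentile f b x β) / δ := by
  have hg := percentile_mem_Icc hf1 b x β
  have hP0 := winnerCDF_pos hδ0 hδ1 hlam hg
  have hP1 := winnerCDF_le_one hδ0 hδ1 hlam hg
  simp only [payoff, winProb_eq, bidWeight, Finset.prod_const, Finset.card_range]
  set P := winnerCDF δ lam (percentile f b x β)
  have hq0 : 0 ≤ 1 - δ := by linarith
  have h0 : 0 ≤ (1 - δ) * (1 - P) := mul_nonneg hq0 (by linarith)
  have h1 : (1 - δ) * (1 - P) < 1 := by nlinarith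
  have h2 : δ + (1 - δ) * P ≠ 0 := by positivity
  have h3 : 1 - (1 - δ) * (1 - P) = δ + (1 - δ) * P := by ring
  have h4 : 1 + (1 - δ) / δ * P = (δ + (1 - δ) * P) / δ := by
    field_simp
  rw [tsum_mul_right, tsum_geometric_of_lt_one h0 h1, h3, h4]
  field_simp

/-- A one-shot deviation argument: the hypothesis on each single bid says that the continuation
value `M / δ` satisfies the Bellman inequality `hstep`. -/
theorem payoff_le (hδ0 : 0 < δ) (hδ1 : δ ≤ 1) (hlam : 0 ≤ lam)
    (hf1 : IsProbabilityMeasure (valueLaw f)) {x M : ℝ} {β : ℕ → ℝ} (hM : 0 ≤ M)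
    (h : ∀ n, (x - β n) * bidWeight δ lam (percentile f b x (β n)) ≤ M) :
    payoff δ lam f b x β ≤ M / δ := by
  have hq0 : 0 ≤ 1 - δ := by linarith
  have hMδ : 0 ≤ M / δ := div_nonneg hM hδ0.le
  set P : ℕ → ℝ := fun n => winnerCDF δ lam (percentile f b x (β n)) with hP
  have hP0 : ∀ n, 0 < P n := fun n => winnerCDF_pos hδ0 hδ1 hlam (percentile_mem_Icc hf1 _ _ _)
  have hP1 : ∀ n, P n ≤ 1 := fun n => winnerCDF_le_one hδ0 hδ1 hlam (percentile_mem_Icc hf1 _ _ _)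
  have hstep : ∀ n, P n * (x - β n) + (1 - δ) * (1 - P n) * (M / δ) ≤ M / δ := fun n => by
    have h1 : 0 < 1 + (1 - δ) / δ * P n := by
      have := hP0 n
      positivity
    have h2 := h n
    rw [bidWeight, ← mul_div_assoc, div_le_iff₀ h1] at h2
    have h3 : M / δ - (1 - δ) * (1 - P n) * (M / δ) = M * (1 + (1 - δ) / δ * P n) := by
      field_simp
      ring
    change (x - β n) * P n ≤ _ at h2
    linarith
  set R : ℕ → ℝ := fun n => ∏ m ∈ Finset.range n, (1 - δ) * (1 - P m) with hR
  have hR0 : ∀ n, 0 ≤ R n := fun n =>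
    Finset.prod_nonneg fun m _ => mul_nonneg hq0 (sub_nonneg.mpr (hP1 m))
  have hpart : ∀ N, ∑ n ∈ Finset.range N, R n * (P n * (x - β n)) + R N * (M / δ) ≤ M / δ := by
    intro N
    induction N with
    | zero => simp [hR]
    | succ N ih =>
      have hRs : R (N + 1) = R N * ((1 - δ) * (1 - P N)) := Finset.prod_range_succ _ _
      rw [Finset.sum_range_succ, hRs]
      nlinarith [mul_le_mul_of_nonneg_left (hstep N) (hR0 N)]
  have heq : payoff δ lam f b x β = ∑' n, R n * (P n * (x - β n)) := by
    simp only [payoff, winProb_eq, hR, hP]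
  rw [heq]
  by_cases hs : Summable fun n => R n * (P n * (x - β n))
  · refine le_of_tendsto' hs.hasSum.tendsto_sum_nat fun N => ?_
    have := hpart N
    have := mul_nonneg (hR0 N) hMδ
    linarith
  -- `β` need not be bounded here; a divergent series has the default sum `0`, which is covered by
  -- `0 ≤ M`.
  · rw [tsum_eq_zero_of_not_summable hs]
    exact hMδ

/-- A bidding function is an equilibrium if and only if no bidder can gain by a plan that makes the
same bid in every round. -/
theorem isEquilibrium_iff (hδ0 : 0 < δ) (hδ1 : δ ≤ 1) (hlam : 0 ≤ lam)
    (hf1 : IsProbabilityMeasure (valueLaw f)) (hneg : valueLaw f (Iio 0) = 0) :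
    IsEquilibrium δ lam f b ↔ ∀ x ∈ (valueLaw f).support, 0 ≤ b x ∧ ∀ β, 0 ≤ β →
      (x - β) * bidWeight δ lam (percentile f b x β) ≤
        (x - b x) * bidWeight δ lam (percentile f b x (b x)) := by
  refine forall₂_congr fun x hx => and_congr_right fun _ => ⟨fun h β hβ => ?_, fun h β hβ _ => ?_⟩
  · have := h (fun _ => β) (fun _ => hβ) (by simp)
    rwa [payoff_const hδ0 hδ1 hlam hf1, payoff_const hδ0 hδ1 hlam hf1,
      div_le_div_iff_of_pos_right hδ0] at this
  · rw [payoff_const hδ0 hδ1 hlam hf1]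
    refine payoff_le hδ0 hδ1 hlam hf1 ?_ fun n => h _ (hβ n)
    -- Bidding one's own value `x ≥ 0` yields zero, so the optimal surplus is nonnegative.
    simpa using h x (support_subset_Ici hneg hx)

end Payoff

/-! ### The bidding formula -/

section Formula

variable {δ lam : ℝ} {f : ℝ → ℝ}

theorem bidIntegrand_eq (δ lam : ℝ) (f : ℝ → ℝ) (z : ℝ) :
    bidIntegrand δ lam f z = z * (bidWeightDensity δ lam (valueCDF f z) * f z) := by
  rw [bidIntegrand, bidWeightDensity]
  ring

theorem continuous_bidWeightDensity_valueCDF (hδ0 : 0 < δ) (hδ1 : δ ≤ 1) (hlam : 0 ≤ lam)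
    (hf : Measurable f) (hf0 : ∀ x, 0 ≤ f x) (hf1 : IsProbabilityMeasure (valueLaw f)) :
    Continuous fun z => bidWeightDensity δ lam (valueCDF f z) :=
  (continuousOn_bidWeightDensity hδ0 hδ1 hlam).comp_continuous (continuous_valueCDF hf hf0 hf1)
    (valueCDF_mem_Icc f)

theorem locallyIntegrable_bidIntegrand (hδ0 : 0 < δ) (hδ1 : δ ≤ 1) (hlam : 0 ≤ lam)
    (hf : Measurable f) (hf0 : ∀ x, 0 ≤ f x) (hf1 : IsProbabilityMeasure (valueLaw f)) :
    LocallyIntegrable (bidIntegrand δ lam f) := by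
  have h := (integrable_density hf hf0 hf1).locallyIntegrable.continuous_mul
    (continuous_id.mul (continuous_bidWeightDensity_valueCDF hδ0 hδ1 hlam hf hf0 hf1))
  convert! h using 1
  funext z
  rw [bidIntegrand_eq]
  simp [mul_assoc]

theorem intervalIntegrable_bidIntegrand (hδ0 : 0 < δ) (hδ1 : δ ≤ 1) (hlam : 0 ≤ lam)
    (hf : Measurable f) (hf0 : ∀ x, 0 ≤ f x) (hf1 : IsProbabilityMeasure (valueLaw f)) (a b : ℝ) :
    IntervalIntegrable (bidIntegrand δ lam f) volume a b :=
  ((locallyIntegrable_bidIntegrand hδ0 hδ1 hlam hf hf0 hf1).integrableOn_isCompact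
    isCompact_uIcc).intervalIntegrable

/-- The bracket in the formula is the reciprocal of `bidWeight`, so the expected payment is a plain
integral. -/
theorem bidFormula_mul_bidWeight (hδ0 : 0 < δ) (hδ1 : δ ≤ 1) (hlam : 0 ≤ lam) (f : ℝ → ℝ)
    (x : ℝ) : bidFormula δ lam f x * bidWeight δ lam (valueCDF f x) =
      ∫ z in (lowestValue f)..x, bidIntegrand δ lam f z := by
  have h0 := (winnerCDF_pos hδ0 hδ1 hlam (valueCDF_mem_Icc f x)).ne'
  have h1 := (one_add_mul_winnerCDF_pos hδ0 hδ1 hlam (valueCDF_mem_Icc f x)).ne'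
  have h2 : (1 / winnerCDF δ lam (valueCDF f x) + (1 - δ) / δ) *
      bidWeight δ lam (valueCDF f x) = 1 := by
    rw [bidWeight, ← mul_div_assoc, div_eq_one_iff_eq h1, add_mul, one_div, inv_mul_cancel₀ h0]
  rw [bidFormula, mul_right_comm, h2, one_mul]

/-- A bidder of value `x` does best with the bid that the formula prescribes for the value `x`. -/
theorem surplus_bidFormula_le (hδ0 : 0 < δ) (hδ1 : δ ≤ 1) (hlam : 0 ≤ lam)
    (hf : Measurable f) (hf0 : ∀ x, 0 ≤ f x) (hf1 : IsProbabilityMeasure (valueLaw f)) (x y : ℝ) :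
    (x - bidFormula δ lam f y) * bidWeight δ lam (valueCDF f y) ≤
      (x - bidFormula δ lam f x) * bidWeight δ lam (valueCDF f x) := by
  obtain ⟨K, hK⟩ := exists_lipschitzOnWith_bidWeight hδ0 hδ1 hlam
  have hftc := integral_comp_valueCDF hf hf0 hf1
    (fun g hg => hasDerivWithinAt_bidWeight hδ0 hδ1 hlam hg)
    (continuousOn_bidWeightDensity hδ0 hδ1 hlam) hK y x
  have hint := intervalIntegrable_bidIntegrand hδ0 hδ1 hlam hf hf0 hf1
  have hψ : IntervalIntegrable (fun z => bidWeightDensity δ lam (valueCDF f z) * f z) volume y x :=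
    (integrable_density hf hf0 hf1).intervalIntegrable.continuousOn_mul
      (continuous_bidWeightDensity_valueCDF hδ0 hδ1 hlam hf hf0 hf1).continuousOn
  have hsplit := intervalIntegral.integral_add_adjacent_intervals (hint (lowestValue f) y)
    (hint y x)
  rw [← bidFormula_mul_bidWeight hδ0 hδ1 hlam, ← bidFormula_mul_bidWeight hδ0 hδ1 hlam] at hsplit
  have hdiff : ∫ z in y..x, (x - z) * (bidWeightDensity δ lam (valueCDF f z) * f z) =
      x * (bidWeight δ lam (valueCDF f x) - bidWeight δ lam (valueCDF f y)) -
        ∫ z in y..x, bidIntegrand δ lam f z := by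
    rw [← hftc, ← intervalIntegral.integral_const_mul,
      ← intervalIntegral.integral_sub (hψ.const_mul x) (hint y x)]
    refine intervalIntegral.integral_congr fun z _ => ?_
    simp only [bidIntegrand_eq]
    ring
  have hnn : ∀ z, 0 ≤ bidWeightDensity δ lam (valueCDF f z) * f z := fun z =>
    mul_nonneg (bidWeightDensity_nonneg hδ0 hδ1 hlam _) (hf0 z)
  -- This integral is the gain of bidding as `x` over bidding as `y`. When `x ≤ y`, both the factor
  -- `x - z` and the orientation change sign.
  have hpos : 0 ≤ ∫ z in y..x, (x - z) * (bidWeightDensity δ lam (valueCDF f z) * f z) := by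
    rcases le_total y x with h | h
    · exact intervalIntegral.integral_nonneg h fun z hz =>
        mul_nonneg (sub_nonneg.mpr hz.2) (hnn z)
    · rw [intervalIntegral.integral_symm, ← intervalIntegral.integral_neg]
      exact intervalIntegral.integral_nonneg h fun z hz => by
        rw [← neg_mul]
        exact mul_nonneg (by linarith [hz.1]) (hnn z)
  linarith

theorem bidFormula_lowestValue (δ lam : ℝ) (f : ℝ → ℝ) :
    bidFormula δ lam f (lowestValue f) = 0 := by
  simp [bidFormula]

/-- Imitate the lowest type, who bids `0` and has percentile `0`. -/
theorem mul_bidWeight_zero_le_surplus (hδ0 : 0 < δ) (hδ1 : δ ≤ 1) (hlam : 0 ≤ lam)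
    (hf : Measurable f) (hf0 : ∀ x, 0 ≤ f x) (hf1 : IsProbabilityMeasure (valueLaw f))
    (hneg : valueLaw f (Iio 0) = 0) (x : ℝ) :
    x * bidWeight δ lam 0 ≤ (x - bidFormula δ lam f x) * bidWeight δ lam (valueCDF f x) := by
  have h := surplus_bidFormula_le hδ0 hδ1 hlam hf hf0 hf1 x (lowestValue f)
  rwa [bidFormula_lowestValue, valueCDF_lowestValue hf1 hneg, sub_zero] at h

theorem bidFormula_lt (hδ0 : 0 < δ) (hδ1 : δ ≤ 1) (hlam : 0 ≤ lam)
    (hf : Measurable f) (hf0 : ∀ x, 0 ≤ f x) (hf1 : IsProbabilityMeasure (valueLaw f))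
    (hneg : valueLaw f (Iio 0) = 0) {x : ℝ} (hx : 0 < x) : bidFormula δ lam f x < x := by
  have h := mul_bidWeight_zero_le_surplus hδ0 hδ1 hlam hf hf0 hf1 hneg x
  have h0 := bidWeight_pos hδ0 hδ1 hlam (left_mem_Icc.mpr (zero_le_one (α := ℝ)))
  exact sub_pos.mp (pos_of_mul_pos_left ((mul_pos hx h0).trans_le h)
    (bidWeight_pos hδ0 hδ1 hlam (valueCDF_mem_Icc f x)).le)

theorem bidFormula_le (hδ0 : 0 < δ) (hδ1 : δ ≤ 1) (hlam : 0 ≤ lam)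
    (hf : Measurable f) (hf0 : ∀ x, 0 ≤ f x) (hf1 : IsProbabilityMeasure (valueLaw f))
    (hneg : valueLaw f (Iio 0) = 0) {x : ℝ} (hx : 0 ≤ x) : bidFormula δ lam f x ≤ x := by
  have h := mul_bidWeight_zero_le_surplus hδ0 hδ1 hlam hf hf0 hf1 hneg x
  have h0 := bidWeight_pos hδ0 hδ1 hlam (left_mem_Icc.mpr (zero_le_one (α := ℝ)))
  exact sub_nonneg.mp (nonneg_of_mul_nonneg_left ((mul_nonneg hx h0.le).trans h)
    (bidWeight_pos hδ0 hδ1 hlam (valueCDF_mem_Icc f x)))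

/-- If type `x` does not gain by imitating a higher `y`, who wins at least as often, then `y` must
bid at least as much. -/
theorem monotoneOn_bidFormula (hδ0 : 0 < δ) (hδ1 : δ ≤ 1) (hlam : 0 ≤ lam)
    (hf : Measurable f) (hf0 : ∀ x, 0 ≤ f x) (hf1 : IsProbabilityMeasure (valueLaw f))
    (hneg : valueLaw f (Iio 0) = 0) : MonotoneOn (bidFormula δ lam f) (Ici 0) := by
  intro x hx y _ hxy
  have h1 := surplus_bidFormula_le hδ0 hδ1 hlam hf hf0 hf1 x y
  have h2 := monotoneOn_bidWeight hδ0 hδ1 hlam (valueCDF_mem_Icc f x) (valueCDF_mem_Icc f y)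
    (monotone_valueCDF f hxy)
  have h3 := h1.trans (mul_le_mul_of_nonneg_left h2
    (sub_nonneg.mpr (bidFormula_le hδ0 hδ1 hlam hf hf0 hf1 hneg hx)))
  have h4 := le_of_mul_le_mul_right h3 (bidWeight_pos hδ0 hδ1 hlam (valueCDF_mem_Icc f y))
  linarith

theorem solvesBiddingODEAt (hδ0 : 0 < δ) (hδ1 : δ ≤ 1) (hlam : 0 ≤ lam)
    (hf : Measurable f) (hf0 : ∀ x, 0 ≤ f x) (hf1 : IsProbabilityMeasure (valueLaw f))
    (hneg : valueLaw f (Iio 0) = 0) {x : ℝ} (hx : lowestValue f < x)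
    (hF : HasDerivAt (valueCDF f) (f x) x)
    (hI : HasDerivAt (fun y => ∫ z in (lowestValue f)..y, bidIntegrand δ lam f z)
      (bidIntegrand δ lam f x) x) :
    SolvesBiddingODEAt δ lam f (bidFormula δ lam f) x := by
  have hlt := bidFormula_lt hδ0 hδ1 hlam hf hf0 hf1 hneg
    ((lowestValue_nonneg hf1 hneg).trans_lt hx)
  have hW0 := (winnerCDF_pos hδ0 hδ1 hlam (valueCDF_mem_Icc f x)).ne'
  have hκ := (one_add_mul_winnerCDF_pos hδ0 hδ1 hlam (valueCDF_mem_Icc f x)).ne'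
  have hW : HasDerivAt (fun y => winnerCDF δ lam (valueCDF f y))
      (winnerDensity δ lam (valueCDF f x) * f x) x :=
    (hasDerivWithinAt_winnerCDF hδ0 hδ1 hlam (valueCDF_mem_Icc f x)).comp_hasDerivAt x hF
      (Eventually.of_forall (valueCDF_mem_Icc f))
  have hB := ((hW.fun_inv hW0).add_const ((1 - δ) / δ)).fun_mul hI
  have hfun : bidFormula δ lam f = fun y => ((winnerCDF δ lam (valueCDF f y))⁻¹ + (1 - δ) / δ) *
      ∫ z in (lowestValue f)..y, bidIntegrand δ lam f z := by
    funext y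
    rw [bidFormula, one_div]
  rw [← hfun, ← bidFormula_mul_bidWeight hδ0 hδ1 hlam] at hB
  refine ⟨hlt, hB.differentiableAt, ?_⟩
  -- In `hB` the integral has been replaced by `b(x) Ψ(F x)`, so the equation is now algebraic.
  rw [hB.deriv, div_eq_iff (sub_pos.mpr hlt).ne', bidIntegrand, bidWeight]
  field_simp
  ring

end Formula

/-! ### Equilibrium -/

section Equilibrium

variable {δ lam : ℝ} {f b : ℝ → ℝ}

theorem measureReal_mono_on_support (hf1 : IsProbabilityMeasure (valueLaw f)) {A B : Set ℝ}
    (h : ∀ z ∈ (valueLaw f).support, z ∈ A → z ∈ B) :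
    (valueLaw f).real A ≤ (valueLaw f).real B := by
  refine ENNReal.toReal_mono (measure_ne_top _ _) (measure_mono_ae ?_)
  filter_upwards [valueLaw_ae_mem_support f] with z hz hzA using h z hz hzA

theorem exists_valueCDF_eq (hf : Measurable f) (hf0 : ∀ x, 0 ≤ f x)
    (hf1 : IsProbabilityMeasure (valueLaw f)) {c : ℝ} (hc : c ∈ Ioo (0 : ℝ) 1) :
    ∃ y, valueCDF f y = c := by
  have h0 := (ProbabilityTheory.tendsto_cdf_atBot (valueLaw f)).eventually_lt_const hc.1
  have h1 := (ProbabilityTheory.tendsto_cdf_atTop (valueLaw f)).eventually_const_lt hc.2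
  obtain ⟨y0, hy0⟩ := h0.exists
  obtain ⟨y1, hy1⟩ := h1.exists
  exact mem_range_of_exists_le_of_exists_ge (continuous_valueCDF hf hf0 hf1)
    ⟨y0, hy0.le⟩ ⟨y1, hy1.le⟩

/-- Half of the fact that `F(X)` is uniform for continuous `F`; levels `c' > c` attained by `F`
approximate `c`. -/
theorem one_sub_le_measureReal_lt_valueCDF (hf : Measurable f) (hf0 : ∀ x, 0 ≤ f x)
    (hf1 : IsProbabilityMeasure (valueLaw f)) {c : ℝ} (hc : 0 ≤ c) :
    1 - c ≤ (valueLaw f).real {z | c < valueCDF f z} := by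
  rw [sub_le_iff_le_add', ← sub_le_iff_le_add]
  refine le_of_forall_gt_imp_ge_of_dense fun c' hc' => ?_
  rcases lt_or_ge c' 1 with h1 | h1
  · obtain ⟨y, hy⟩ := exists_valueCDF_eq hf hf0 hf1 ⟨hc.trans_lt hc', h1⟩
    have h2 : Ioi y ⊆ {z | c < valueCDF f z} := fun z hz =>
      (hc'.trans_eq hy.symm).trans_le (monotone_valueCDF f (le_of_lt hz))
    have h3 := measureReal_mono (μ := valueLaw f) h2
    rw [valueLaw_real_Ioi hf1, hy] at h3
    linarith
  · linarith [measureReal_nonneg (μ := valueLaw f) (s := {z | c < valueCDF f z})]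

/-- The support may have gaps: move an intermediate point down to the nearest support point, which
crosses no mass. -/
theorem exists_mem_support_valueCDF_eq (hf : Measurable f) (hf0 : ∀ x, 0 ≤ f x)
    (hf1 : IsProbabilityMeasure (valueLaw f)) {x y v : ℝ} (hy : y ∈ (valueLaw f).support)
    (hyx : y ≤ x) (hv : v ∈ Icc (valueCDF f y) (valueCDF f x)) :
    ∃ m ∈ (valueLaw f).support, m ∈ Icc y x ∧ valueCDF f m = v := by
  obtain ⟨m₀, hm₀, rfl⟩ := intermediate_value_Icc hyx
    (continuous_valueCDF hf hf0 hf1).continuousOn hv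
  set T := (valueLaw f).support ∩ Iic m₀
  have hTb : BddAbove T := ⟨m₀, fun z hz => hz.2⟩
  have hyT : y ∈ T := ⟨hy, hm₀.1⟩
  have hmT : sSup T ∈ T :=
    (Measure.isClosed_support.inter isClosed_Iic).csSup_mem ⟨y, hyT⟩ hTb
  refine ⟨sSup T, hmT.1, ⟨le_csSup hTb hyT, hmT.2.trans hm₀.2⟩, ?_⟩
  refine le_antisymm (monotone_valueCDF f hmT.2) ?_
  rw [valueCDF_eq hf1, valueCDF_eq hf1]
  exact measureReal_mono_on_support hf1 fun z hz hzm => le_csSup hTb ⟨hz, hzm⟩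

/-- A function on the support whose increments are of second order is constant. -/
theorem eq_of_abs_sub_le_mul_valueCDF (hf : Measurable f) (hf0 : ∀ x, 0 ≤ f x)
    (hf1 : IsProbabilityMeasure (valueLaw f)) {D : ℝ → ℝ} {K : ℝ}
    (hD : ∀ y ∈ (valueLaw f).support, ∀ x ∈ (valueLaw f).support, y ≤ x →
      |D x - D y| ≤ K * ((x - y) * (valueCDF f x - valueCDF f y)))
    {x y : ℝ} (hy : y ∈ (valueLaw f).support) (hx : x ∈ (valueLaw f).support) (hyx : y ≤ x) :
    D x = D y := by
  have key : ∀ n : ℕ, ∀ y ∈ (valueLaw f).support, ∀ x ∈ (valueLaw f).support, y ≤ x →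
      |D x - D y| ≤ K * ((x - y) * (valueCDF f x - valueCDF f y)) * (1 / 2) ^ n := by
    intro n
    induction n with
    | zero => simpa using hD
    | succ n ih =>
      intro y hy x hx hyx
      have hF := monotone_valueCDF f hyx
      -- Splitting at the midpoint in probability halves both `F`-increments while the lengths add
      -- up, so the total bound halves.
      obtain ⟨m, hm, hmI, hFm⟩ := exists_mem_support_valueCDF_eq hf hf0 hf1 hy hyx
        (v := (valueCDF f x + valueCDF f y) / 2) ⟨by linarith, by linarith⟩
      have h1 := ih y hy m hm hmI.1
      have h2 := ih m hm x hx hmI.2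
      rw [hFm] at h1 h2
      calc |D x - D y| ≤ |D x - D m| + |D m - D y| := abs_sub_le _ _ _
        _ ≤ _ := add_le_add h2 h1
        _ = _ := by ring
  have hlim : Tendsto (fun n : ℕ => K * ((x - y) * (valueCDF f x - valueCDF f y)) * (1 / 2) ^ n)
      atTop (𝓝 0) := by
    simpa using (tendsto_pow_atTop_nhds_zero_of_lt_one (by norm_num : (0 : ℝ) ≤ 1 / 2)
      (by norm_num)).const_mul (K * ((x - y) * (valueCDF f x - valueCDF f y)))
  have h0 : |D x - D y| ≤ 0 := ge_of_tendsto' hlim fun n => key n y hy x hx hyx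
  exact sub_eq_zero.mp (abs_nonpos_iff.mp h0)

theorem isEquilibrium_of_eqOn (hδ0 : 0 < δ) (hδ1 : δ ≤ 1) (hlam : 0 ≤ lam)
    (hf : Measurable f) (hf0 : ∀ x, 0 ≤ f x) (hf1 : IsProbabilityMeasure (valueLaw f))
    (hneg : valueLaw f (Iio 0) = 0)
    (hb : EqOn b (bidFormula δ lam f) (valueLaw f).support) : IsEquilibrium δ lam f b := by
  have hS := support_subset_Ici hneg
  have hmono := monotoneOn_bidFormula hδ0 hδ1 hlam hf hf0 hf1 hneg
  have hΨmono := monotoneOn_bidWeight hδ0 hδ1 hlam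
  have hle := surplus_bidFormula_le hδ0 hδ1 hlam hf hf0 hf1
  have hΨpos : ∀ {g}, g ∈ Icc (0 : ℝ) 1 → 0 < bidWeight δ lam g := bidWeight_pos hδ0 hδ1 hlam
  rw [isEquilibrium_iff hδ0 hδ1 hlam hf1 hneg]
  intro x hx
  have hx0 : 0 ≤ x := hS hx
  refine ⟨?_, fun β hβ => ?_⟩
  · rw [hb hx, ← bidFormula_lowestValue δ lam f]
    exact hmono (lowestValue_nonneg hf1 hneg) hx0 (lowestValue_le hneg hx)
  set U := (x - bidFormula δ lam f x) * bidWeight δ lam (valueCDF f x) with hU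
  have hU0 : x * bidWeight δ lam 0 ≤ U :=
    mul_bidWeight_zero_le_surplus hδ0 hδ1 hlam hf hf0 hf1 hneg x
  have h01 : (0 : ℝ) ∈ Icc (0 : ℝ) 1 := left_mem_Icc.mpr zero_le_one
  have hwin : U ≤ (x - b x) * bidWeight δ lam (percentile f b x (b x)) := by
    rw [hb hx]
    refine mul_le_mul_of_nonneg_left (hΨmono (valueCDF_mem_Icc f x)
      (percentile_mem_Icc hf1 _ _ _) ?_)
      (sub_nonneg.mpr (bidFormula_le hδ0 hδ1 hlam hf hf0 hf1 hneg hx0))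
    rw [percentile, le_sub_comm, ← valueLaw_real_Ioi hf1]
    refine measureReal_mono_on_support hf1 fun z hz hzA => ?_
    by_contra hzx
    have hzx' : z ≤ x := not_lt.mp hzx
    have hbz := hmono (hS hz) hx0 hzx'
    rcases hzA with h | h
    · rw [hb hz] at h
      exact absurd h (not_lt.mpr hbz)
    · exact hzx h.2
  refine le_trans ?_ hwin
  rcases le_or_gt x β with hxβ | hxβ
  · exact (mul_nonpos_of_nonpos_of_nonneg (sub_nonpos.mpr hxβ)
      (hΨpos (percentile_mem_Icc hf1 _ _ _)).le).trans
      ((mul_nonneg hx0 (hΨpos h01).le).trans hU0)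
  -- `T` collects the percentiles at which the bid `β` would be harmless. It contains `F z` for
  -- every `z` in the support with `b z ≤ β`, so all types with `F z > sSup T` outbid `β`.
  set T := Icc (0 : ℝ) 1 ∩ {v | (x - β) * bidWeight δ lam v ≤ U} with hT
  have hTc : IsCompact T := by
    have hΨc : ContinuousOn (bidWeight δ lam) (Icc 0 1) := fun g hg =>
      (hasDerivWithinAt_bidWeight hδ0 hδ1 hlam hg).continuousWithinAt
    exact isCompact_Icc.of_isClosed_subset
      ((continuousOn_const.mul hΨc).preimage_isClosed_of_isClosed isClosed_Icc isClosed_Iic)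
      inter_subset_left
  have h0T : (0 : ℝ) ∈ T :=
    ⟨h01, (mul_le_mul_of_nonneg_right (sub_le_self x hβ) (hΨpos h01).le).trans hU0⟩
  have hcT := hTc.sSup_mem ⟨0, h0T⟩
  have hper : percentile f b x β ≤ sSup T := by
    rw [percentile, sub_le_comm]
    refine (one_sub_le_measureReal_lt_valueCDF hf hf0 hf1 hcT.1.1).trans
      (measureReal_mono_on_support hf1 fun z hz hzc => ?_)
    by_contra hzA
    have hbz : b z ≤ β := by
      by_contra hlt
      exact hzA (Or.inl (not_le.mp hlt))
    refine absurd (le_csSup hTc.bddAbove ?_) (not_le.mpr hzc)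
    refine ⟨valueCDF_mem_Icc f z, le_trans ?_ (hle x z)⟩
    rw [← hb hz]
    exact mul_le_mul_of_nonneg_right (by linarith) (hΨpos (valueCDF_mem_Icc f z)).le
  exact (mul_le_mul_of_nonneg_left (hΨmono (percentile_mem_Icc hf1 _ _ _) hcT.1 hper)
    (sub_nonneg.mpr hxβ.le)).trans hcT.2

/-- The surplus of a bidder in equilibrium is an upper envelope: no bidder gains by imitating a
bidder of another value, and she wins as often as under an increasing bidding function. -/
theorem IsEquilibrium.surplus (hδ0 : 0 < δ) (hδ1 : δ ≤ 1) (hlam : 0 ≤ lam)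
    (hf1 : IsProbabilityMeasure (valueLaw f))
    (hneg : valueLaw f (Iio 0) = 0) (hb : IsEquilibrium δ lam f b) :
    (∀ x ∈ (valueLaw f).support,
      x * bidWeight δ lam 0 ≤ (x - b x) * bidWeight δ lam (valueCDF f x)) ∧
    ∀ x ∈ (valueLaw f).support, ∀ y ∈ (valueLaw f).support,
      (x - b y) * bidWeight δ lam (valueCDF f y) ≤
        (x - b x) * bidWeight δ lam (valueCDF f x) := by
  rw [isEquilibrium_iff hδ0 hδ1 hlam hf1 hneg] at hb
  have hS := support_subset_Ici hneg
  have hΨpos : ∀ {g}, g ∈ Icc (0 : ℝ) 1 → 0 < bidWeight δ lam g := bidWeight_pos hδ0 hδ1 hlam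
  have hΨmono := monotoneOn_bidWeight hδ0 hδ1 hlam
  have h01 : (0 : ℝ) ∈ Icc (0 : ℝ) 1 := left_mem_Icc.mpr zero_le_one
  have hper := percentile_mem_Icc hf1 b
  set V : ℝ → ℝ := fun x => (x - b x) * bidWeight δ lam (percentile f b x (b x)) with hV
  -- The percentile reached by a bidder who bids `β` and wins every tie; bidding slightly above `β`
  -- reaches at least this percentile.
  set m : ℝ → ℝ := fun β => 1 - (valueLaw f).real {z | β < b z} with hm
  have hmI : ∀ β, m β ∈ Icc (0 : ℝ) 1 := fun β => one_sub_measureReal_mem_Icc hf1 _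
  have hmmono : Monotone m := fun β β' h =>
    sub_le_sub_left (measureReal_mono fun z hz => lt_of_le_of_lt h hz) 1
  have hV0 : ∀ x ∈ (valueLaw f).support, x * bidWeight δ lam 0 ≤ V x := fun x hx => by
    have h1 := (hb x hx).2 0 le_rfl
    rw [sub_zero] at h1
    exact (mul_le_mul_of_nonneg_left (hΨmono h01 (hper x 0) (hper x 0).1) (hS hx)).trans h1
  have hVnn : ∀ x ∈ (valueLaw f).support, 0 ≤ V x := fun x hx =>
    (mul_nonneg (hS hx) (hΨpos h01).le).trans (hV0 x hx)
  have hbx : ∀ x ∈ (valueLaw f).support, b x ≤ x := fun x hx =>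
    sub_nonneg.mp (nonneg_of_mul_nonneg_left (hVnn x hx) (hΨpos (hper x (b x))))
  -- deviations to bids just above `β`
  have hdev : ∀ x ∈ (valueLaw f).support, ∀ β, 0 ≤ β → (x - β) * bidWeight δ lam (m β) ≤ V x := by
    intro x hx β hβ
    have hpos := hΨpos (hmI β)
    refine le_of_forall_pos_le_add fun ε hε => ?_
    set η := ε / bidWeight δ lam (m β) with hη
    have hη0 : 0 < η := div_pos hε hpos
    have hηε : η * bidWeight δ lam (m β) = ε := div_mul_cancel₀ _ hpos.ne'
    suffices (x - (β + η)) * bidWeight δ lam (m β) ≤ V x by linarith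
    rcases le_or_gt x (β + η) with h | h
    · exact (mul_nonpos_of_nonpos_of_nonneg (sub_nonpos.mpr h) hpos.le).trans (hVnn x hx)
    · refine (mul_le_mul_of_nonneg_left (hΨmono (hmI β) (hper x (β + η)) ?_)
        (sub_nonneg.mpr h.le)).trans ((hb x hx).2 (β + η) (by positivity))
      refine sub_le_sub_left (measureReal_mono fun z hz => ?_) 1
      rcases hz with hz | hz
      · exact (lt_add_of_pos_right β hη0).trans hz
      · exact (lt_add_of_pos_right β hη0).trans_eq hz.1.symm
  have hVm : ∀ x ∈ (valueLaw f).support, V x = (x - b x) * bidWeight δ lam (m (b x)) :=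
    fun x hx => le_antisymm
      (mul_le_mul_of_nonneg_left (hΨmono (hper x (b x)) (hmI (b x))
        (sub_le_sub_left (measureReal_mono fun z hz => Or.inl hz) 1))
        (sub_nonneg.mpr (hbx x hx)))
      (hdev x hx (b x) (hb x hx).1)
  -- Single crossing: if `b y < b x`, adding the two no-imitation inequalities forces equal winning
  -- weights, and then `x` would prefer the cheaper bid.
  have hbmono : ∀ x ∈ (valueLaw f).support, ∀ y ∈ (valueLaw f).support, x ≤ y → b x ≤ b y := by
    intro x hx y hy hxy
    by_contra! h
    have h1 := hdev x hx (b y) (hb y hy).1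
    have h2 := hdev y hy (b x) (hb x hx).1
    rw [hVm x hx] at h1
    rw [hVm y hy] at h2
    have h3 := hΨmono (hmI (b y)) (hmI (b x)) (hmmono h.le)
    have h4 := hΨpos (hmI (b x))
    rcases hxy.eq_or_lt with rfl | hlt
    · exact lt_irrefl _ h
    · have h5 : bidWeight δ lam (m (b x)) ≤ bidWeight δ lam (m (b y)) :=
        le_of_mul_le_mul_left (by linarith) (sub_pos.mpr hlt)
      rw [le_antisymm h3 h5] at h1
      linarith [le_of_mul_le_mul_right h1 h4]
  -- the bidder of value `x` wins against exactly the bidders of lower value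
  have hVF : ∀ x ∈ (valueLaw f).support, V x = (x - b x) * bidWeight δ lam (valueCDF f x) ∧
      bidWeight δ lam (valueCDF f x) ≤ bidWeight δ lam (m (b x)) := by
    intro x hx
    have h1 : bidWeight δ lam (valueCDF f x) ≤ bidWeight δ lam (m (b x)) := by
      refine hΨmono (valueCDF_mem_Icc f x) (hmI _) ?_
      rw [hm, le_sub_comm, ← valueLaw_real_Ioi hf1]
      refine measureReal_mono_on_support hf1 fun z hz hzA => ?_
      by_contra hzx
      exact absurd (hbmono z hz x hx (not_lt.mp hzx)) (not_le.mpr hzA)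
    have h2 : bidWeight δ lam (percentile f b x (b x)) ≤ bidWeight δ lam (valueCDF f x) := by
      refine hΨmono (hper _ _) (valueCDF_mem_Icc f x) ?_
      rw [percentile, sub_le_comm, ← valueLaw_real_Ioi hf1]
      refine measureReal_mono_on_support hf1 fun z hz hzx => ?_
      rcases (hbmono x hx z hz (le_of_lt hzx)).lt_or_eq with h | h
      · exact Or.inl h
      · exact Or.inr ⟨h.symm, hzx⟩
    have h3 := sub_nonneg.mpr (hbx x hx)
    refine ⟨le_antisymm (mul_le_mul_of_nonneg_left h2 h3) ?_, h1⟩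
    rw [hVm x hx]
    exact mul_le_mul_of_nonneg_left h1 h3
  refine ⟨fun x hx => (hVF x hx).1 ▸ hV0 x hx, fun x hx y hy => ?_⟩
  rw [← (hVF x hx).1]
  rcases (hbx y hy).eq_or_lt with h | h
  · -- only a bidder of value zero bids her value
    have hVy : V y = 0 := by simp [hV, h]
    have hy0 : y = 0 := by
      have := hV0 y hy
      rw [hVy] at this
      exact le_antisymm (nonpos_of_mul_nonpos_left this (hΨpos h01)) (hS hy)
    have hF0 : valueCDF f y = 0 := by
      refine le_antisymm ?_ (valueCDF_mem_Icc f y).1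
      rw [← valueCDF_lowestValue hf1 hneg]
      exact monotone_valueCDF f (hy0 ▸ lowestValue_nonneg hf1 hneg)
    rw [h, hy0, ← hy0, hF0, hy0, sub_zero]
    exact hV0 x hx
  -- Cancelling `y - b y > 0` in the two expressions for `V y` shows that ties at `b y` do not
  -- affect the winning weight.
  · have h1 : bidWeight δ lam (valueCDF f y) = bidWeight δ lam (m (b y)) := by
      have := (hVF y hy).1
      rw [hVm y hy] at this
      exact (mul_left_cancel₀ (sub_pos.mpr h).ne' this).symm
    rw [h1]
    exact hdev x hx (b y) (hb y hy).1

theorem IsEquilibrium.eqOn_bidFormula (hδ0 : 0 < δ) (hδ1 : δ ≤ 1) (hlam : 0 ≤ lam)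
    (hf : Measurable f) (hf0 : ∀ x, 0 ≤ f x) (hf1 : IsProbabilityMeasure (valueLaw f))
    (hneg : valueLaw f (Iio 0) = 0) (hb : IsEquilibrium δ lam f b) :
    EqOn b (bidFormula δ lam f) (valueLaw f).support := by
  obtain ⟨K, hK⟩ := exists_lipschitzOnWith_bidWeight hδ0 hδ1 hlam
  obtain ⟨hV0, hV⟩ := hb.surplus hδ0 hδ1 hlam hf1 hneg
  have hU := surplus_bidFormula_le hδ0 hδ1 hlam hf hf0 hf1
  set ψ : ℝ → ℝ := fun x => bidWeight δ lam (valueCDF f x)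
  have hψpos : ∀ x, 0 < ψ x := fun x => bidWeight_pos hδ0 hδ1 hlam (valueCDF_mem_Icc f x)
  set D : ℝ → ℝ := fun x => (x - b x) * ψ x - (x - bidFormula δ lam f x) * ψ x with hD
  have hinc : ∀ y ∈ (valueLaw f).support, ∀ x ∈ (valueLaw f).support, y ≤ x →
      |D x - D y| ≤ K * ((x - y) * (valueCDF f x - valueCDF f y)) := by
    intro y hy x hx hyx
    have hF := sub_nonneg.mpr (monotone_valueCDF f hyx)
    have hψ : ψ x - ψ y ≤ K * (valueCDF f x - valueCDF f y) := by
      have := hK.dist_le_mul _ (valueCDF_mem_Icc f x) _ (valueCDF_mem_Icc f y)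
      rw [Real.dist_eq, Real.dist_eq, abs_of_nonneg hF] at this
      exact (le_abs_self _).trans this
    have h1 : (x - b y) * ψ y ≤ (x - b x) * ψ x := hV x hx y hy
    have h2 : (y - b x) * ψ x ≤ (y - b y) * ψ y := hV y hy x hx
    have h3 : (x - bidFormula δ lam f y) * ψ y ≤ (x - bidFormula δ lam f x) * ψ x := hU x y
    have h4 : (y - bidFormula δ lam f x) * ψ x ≤ (y - bidFormula δ lam f y) * ψ y := hU y x
    have h5 := mul_le_mul_of_nonneg_left hψ (sub_nonneg.mpr hyx)
    -- For `y ≤ x`, each surplus increases by between `(x - y) ψ(y)` and `(x - y) ψ(x)`, so the two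
    -- increments differ by at most `(x - y) (ψ(x) - ψ(y))`.
    rw [abs_le]
    simp only [hD]
    constructor <;> nlinarith
  have hX := lowestValue_mem_support hf1 hneg
  have hb0 := (hb _ hX).1
  intro x hx
  have hconst := eq_of_abs_sub_le_mul_valueCDF hf hf0 hf1 hinc hX hx (lowestValue_le hneg hx)
  -- The lowest type has percentile `0` anyway, so bidding `0` costs her no winning weight and a
  -- positive bid would be wasteful.
  have hbX : b (lowestValue f) = 0 := by
    have h1 := hV0 _ hX
    rw [valueCDF_lowestValue hf1 hneg] at h1
    have h2 := le_of_mul_le_mul_right h1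
      (bidWeight_pos hδ0 hδ1 hlam (left_mem_Icc.mpr (zero_le_one (α := ℝ))))
    linarith
  simp only [hD, hbX, bidFormula_lowestValue, sub_self] at hconst
  have := mul_right_cancel₀ (hψpos x).ne' (sub_eq_zero.mp hconst)
  linarith

end Equilibrium

end UnendingAuction

theorem mainTheorem3 (δ lam : ℝ) (hδ0 : 0 < δ) (hδ1 : δ ≤ 1) (hlam : 0 ≤ lam)
    (f : ℝ → ℝ) (hf : Measurable f) (hf0 : ∀ x, 0 ≤ f x)
    (hf1 : IsProbabilityMeasure (UnendingAuction.valueLaw f))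
    (hneg : UnendingAuction.valueLaw f (Iio 0) = 0) :
    -- `W` is well defined: each thinned chain has exactly one stationary distribution
    (∀ g ∈ Icc (0 : ℝ) 1, ∃! p : ℕ → ℝ, UnendingAuction.IsStationary δ (lam * (1 - g)) p) ∧
    -- `W` is positive and has the continuous density `w`
    (∀ g ∈ Icc (0 : ℝ) 1, 0 < UnendingAuction.winnerCDF δ lam g ∧
      HasDerivWithinAt (UnendingAuction.winnerCDF δ lam)
        (UnendingAuction.winnerDensity δ lam g) (Icc 0 1) g) ∧
    ContinuousOn (UnendingAuction.winnerDensity δ lam) (Icc 0 1) ∧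
    -- the integral in the bidding formula exists
    (∀ x, UnendingAuction.lowestValue f ≤ x →
      IntervalIntegrable (UnendingAuction.bidIntegrand δ lam f) volume
        (UnendingAuction.lowestValue f) x) ∧
    -- in equilibrium, and only then, bids are given by the bidding formula
    (∀ b : ℝ → ℝ, UnendingAuction.IsEquilibrium δ lam f b ↔
      EqOn b (UnendingAuction.bidFormula δ lam f) (UnendingAuction.valueLaw f).support) ∧
    -- the bid is weakly increasing in the value
    MonotoneOn (UnendingAuction.bidFormula δ lam f) (Ici (UnendingAuction.lowestValue f)) ∧
    -- the bidding formula solves the differential equation, almost everywhere and at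
    -- every continuity point of the density
    (∀ᵐ x, UnendingAuction.lowestValue f < x →
      UnendingAuction.SolvesBiddingODEAt δ lam f (UnendingAuction.bidFormula δ lam f) x) ∧
    (∀ x, UnendingAuction.lowestValue f < x → ContinuousAt f x →
      UnendingAuction.SolvesBiddingODEAt δ lam f (UnendingAuction.bidFormula δ lam f) x) := by
  open UnendingAuction in
  have hloc := locallyIntegrable_bidIntegrand hδ0 hδ1 hlam hf hf0 hf1
  have hint := intervalIntegrable_bidIntegrand hδ0 hδ1 hlam hf hf0 hf1
  have hfi := integrable_density hf hf0 hf1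
  refine ⟨fun g hg => existsUnique_isStationary hδ0 hδ1 (mul_one_sub_nonneg hlam hg),
    fun g hg => ⟨winnerCDF_pos hδ0 hδ1 hlam hg, hasDerivWithinAt_winnerCDF hδ0 hδ1 hlam hg⟩,
    continuousOn_winnerDensity hδ0 hδ1 hlam, fun x _ => hint _ x,
    fun b => ⟨fun hb => hb.eqOn_bidFormula hδ0 hδ1 hlam hf hf0 hf1 hneg,
      isEquilibrium_of_eqOn hδ0 hδ1 hlam hf hf0 hf1 hneg⟩,
    (monotoneOn_bidFormula hδ0 hδ1 hlam hf hf0 hf1 hneg).mono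
      (Ici_subset_Ici.mpr (lowestValue_nonneg hf1 hneg)), ?_, fun x hx hfx => ?_⟩
  · filter_upwards [LocallyIntegrable.ae_hasDerivAt_integral hfi.locallyIntegrable,
      LocallyIntegrable.ae_hasDerivAt_integral hloc] with x h1 h2 hx
    exact solvesBiddingODEAt hδ0 hδ1 hlam hf hf0 hf1 hneg hx
      (hasDerivAt_valueCDF_of_integral hf hf0 hf1 (h1 0)) (h2 _)
  · have hcont : ContinuousAt (bidIntegrand δ lam f) x := by
      rw [funext (bidIntegrand_eq δ lam f)]
      exact continuousAt_id.mul ((continuous_bidWeightDensity_valueCDF hδ0 hδ1 hlam hf hf0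
        hf1).continuousAt.mul hfx)
    exact solvesBiddingODEAt hδ0 hδ1 hlam hf hf0 hf1 hneg hx
      (hasDerivAt_valueCDF_of_integral hf hf0 hf1
        (intervalIntegral.integral_hasDerivAt_right (a := 0) hfi.intervalIntegrable
          hf.stronglyMeasurable.stronglyMeasurableAtFilter hfx))
      (intervalIntegral.integral_hasDerivAt_right (hint _ x)
        hloc.aestronglyMeasurable.stronglyMeasurableAtFilter hcont)
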